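/- **Setting.** Let $n\ge 2$ bidders and $m$ items be given. A valuation vector is $\vec v=(v_1,\dots,v_n)$ with $v_i:2^{[m]}\to\mathbb R$. An allocation $\vec o=(o_1,\dots,o_n)$ consists of pairwise disjoint bundles $o_i\subseteq[m]$; the $(n+1)^m$ allocations are listed in some fixed order $\vec o_1,\vec o_2,\dots$, and ties in an $\operatorname{argmax}$ over allocations are broken in favour of the first one in the list. An *affine maximizer auction* (AMA) $A$ is given by weights $w_1,\dots,w_n>0$ and boosts $\lambda(\vec o)\in\mathbb R$. It chooses $\vec o^*=\operatorname{argmax}_{\vec o}\{\sum_{i}w_iv_i(o_i)+\lambda(\vec o)\}$ and charges bidder $j$ $$p_{j,A}(\vec v)=\frac1{w_j}\Big[\sum_{i\ne j}w_iv_i(o_{-j,i})+\lambda(\vec o_{-j})-\sum_{i\neq j}w_iv_i(o^*_i)-\lambda(\vec o^*)\Big],\qquad \vec o_{-j}=\operatorname{argmax}_{\vec o}\Big\{\sum_{i\ne j}w_iv_i(o_i)+\lambda(\vec o)\Big\}.$$ Its revenue is $rev_A(\vec v)=\sum_j p_{j,A}(\vec v)$. A *VVCA* is an AMA whose boosts have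 the form $\lambda(\vec o)=\sum_i c_{i,o_i}$ with real numbers $c_{i,b}$ ($i\in[n]$, $b\subseteq[m]$); a *$\lambda$-auction* is an AMA with $w_1=\dots=w_n=1$. For a class $\mathcal A$ of auctions, a domain $X$ of valuation vectors and $\epsilon,\delta\in(0,1)$, the *sample complexity of uniform convergence* $N(\epsilon,\delta,\mathcal A)$ on $X$ is the least $M$ such that for every probability distribution $\mathcal D$ on $X$ and every $N\ge M$, with probability at least $1-\delta$ over independent $\vec v^1,\dots,\vec v^N\sim\mathcal D$, every $A\in\mathcal A$ satisfies $\big|\frac1N\sum_{t=1}^N rev_A(\vec v^t)-\mathbb E_{\vec v\sim\mathcal D}[rev_A(\vec v)]\big|\le\epsilon$. **Theorem.** (1) *Upper bound.* There are absolute constants $K>0$ and $k\in\mathbb N$ such that the following holds for all $n\ge2$, $m\ge1$. Let $\mathcal A$ be the class of $n$-bidder, $m$-item AMAs, of VVCAs or of $\lambda$-auctions, or any subclass of one of these (for example the auctions with parameters in given bounds). If $rev_A$ maps $X$ to $[0,U]$ for all $A\in\mathcal A$, then for all $\epsilon,\delta\in(0,1)$ $$N(\epsilon,\delta,\mathcal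 A)\le K\,B\,\big(\log(2+B)\big)^k\log(2/\delta),\qquad B=\Big[\frac U\epsilon\,n^m\sqrt m\,\big(U+n^{m/2}\big)\Big]^2,$$ that is, $N=\widetilde O(B)$. (2) *Lower bounds.* There is an absolute constant $c>0$ such that the following holds for all $n,m\ge2$. Let $X$ be the set of vectors of additive valuation functions in which each item has value $0$ or $1$ for each bidder; all AMA revenues on $X$ lie in $[0,m]$. Then for all $\epsilon,\delta\in(0,1)$, on the domain $X$, $N(\epsilon,\delta,\mathcal A)\ge c\,n^m$ for the class $\mathcal A$ of $\lambda$-auctions, and $N(\epsilon,\delta,\mathcal A)\ge c\,2^m$ for the class $\mathcal A$ of VVCAs. This remains true for any class $\mathcal A$ of AMAs that contains at least the $\lambda$-auctions with all boosts in $[0,1]$, respectively the VVCAs with all weights $1$ and all boosts in $[0,1]$. -/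

import Mathlib

open MeasureTheory
open scoped ENNReal

namespace AuctionLearning

variable {n m : ℕ}

/-- A vector of bidder valuation functions: `v i b` is the value of bidder `i` for the bundle `b`. -/
abbrev ValuationVector (n m : ℕ) : Type := Fin n → Finset (Fin m) → ℝ

/-- An allocation gives every item to one of the bidders or to nobody. There are `(n + 1) ^ m` of
them, and they correspond to the vectors of `n` pairwise disjoint bundles. -/
abbrev Allocation (n m : ℕ) : Type := Fin m → Option (Fin n)

/-- The bundle that bidder `i` receives in the allocation `o`. -/
def bundle (o : Allocation n m) (i : Fin n) : Finset (Fin m) :=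
  Finset.univ.filter fun j => o j = some i

/-- An ordered list `o_1, o_2, …` of all `(n + 1) ^ m` allocations. -/
abbrev Enumeration (n m : ℕ) : Type := Fin ((n + 1) ^ m) ≃ Allocation n m

open Classical in
/-- The indices of the allocations that maximize `f`. -/
noncomputable def maximizers (e : Enumeration n m) (f : Allocation n m → ℝ) :
    Finset (Fin ((n + 1) ^ m)) :=
  Finset.univ.filter fun i => ∀ o, f o ≤ f (e i)

theorem maximizers_nonempty (e : Enumeration n m) (f : Allocation n m → ℝ) :
    (maximizers e f).Nonempty := by
  obtain ⟨o, ho⟩ := Finite.exists_max f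
  exact ⟨e.symm o, by simpa [maximizers] using ho⟩

/-- The allocation that maximizes `f`; ties are broken in favour of the allocation that comes
first in the enumeration `e`. -/
noncomputable def argmax (e : Enumeration n m) (f : Allocation n m → ℝ) : Allocation n m :=
  e ((maximizers e f).min' (maximizers_nonempty e f))

/-- An affine maximizer auction: a positive weight per bidder and a real boost per allocation. -/
structure AMA (n m : ℕ) where
  weight : Fin n → ℝ
  weight_pos : ∀ i, 0 < weight i
  boost : Allocation n m → ℝ

namespace AMA

/-- Boosted weighted welfare of all bidders. -/
def welfare (A : AMA n m) (v : ValuationVector n m) (o : Allocation n m) : ℝ :=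
  (∑ i, A.weight i * v i (bundle o i)) + A.boost o

/-- Boosted weighted welfare of all bidders but `j`. -/
def welfareWithout (A : AMA n m) (v : ValuationVector n m) (j : Fin n) (o : Allocation n m) : ℝ :=
  (∑ i ∈ Finset.univ.erase j, A.weight i * v i (bundle o i)) + A.boost o

/-- The allocation chosen by the auction. -/
noncomputable def outcome (e : Enumeration n m) (A : AMA n m) (v : ValuationVector n m) :
    Allocation n m :=
  argmax e (A.welfare v)

/-- The allocation chosen without the participation of bidder `j`. -/
noncomputable def outcomeWithout (e : Enumeration n m) (A : AMA n m) (v : ValuationVector n m)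
    (j : Fin n) : Allocation n m :=
  argmax e (A.welfareWithout v j)

/-- The payment of bidder `j`. -/
noncomputable def payment (e : Enumeration n m) (A : AMA n m) (v : ValuationVector n m) (j : Fin n) :
    ℝ :=
  1 / A.weight j *
    (A.welfareWithout v j (A.outcomeWithout e v j) - A.welfareWithout v j (A.outcome e v))

/-- The revenue. -/
noncomputable def revenue (e : Enumeration n m) (A : AMA n m) (v : ValuationVector n m) : ℝ :=
  ∑ j, A.payment e v j

end AMA

/-- The class of all `n`-bidder, `m`-item affine maximizer auctions. -/
def AMAs (n m : ℕ) : Set (AMA n m) := Set.univ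

/-- Virtual valuation combinatorial auctions: the boost of an allocation is a sum over the bidders
of terms `c i b` that depend only on the bidder `i` and on the bundle `b` that `i` receives. -/
def VVCAs (n m : ℕ) : Set (AMA n m) :=
  {A | ∃ c : Fin n → Finset (Fin m) → ℝ, ∀ o, A.boost o = ∑ i, c i (bundle o i)}

/-- `λ`-auctions: all bidder weights are one. -/
def lambdaAuctions (n m : ℕ) : Set (AMA n m) :=
  {A | ∀ i, A.weight i = 1}

/-- The average revenue of `A` over the sample `S`. -/
noncomputable def averageRevenue (e : Enumeration n m) (A : AMA n m) {N : ℕ}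
    (S : Fin N → ValuationVector n m) : ℝ :=
  1 / (N : ℝ) * ∑ t, A.revenue e (S t)

/-- The expected revenue of `A` under the distribution `D`. -/
noncomputable def expectedRevenue (e : Enumeration n m) (A : AMA n m)
    (D : Measure (ValuationVector n m)) : ℝ :=
  ∫ v, A.revenue e v ∂D

/-- With probability at least `1 - δ` over `N` independent samples from `D`, average and expected
revenue differ by at most `ε` for all auctions of the class `C` at once. The probability of the
exceptional event is its outer measure, so that its measurability need not be assumed. -/
def UniformlyConverges (e : Enumeration n m) (C : Set (AMA n m)) (D : Measure (ValuationVector n m))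
    (ε δ : ℝ) (N : ℕ) : Prop :=
  Measure.pi (fun _ : Fin N => D)
    {S | ∃ A ∈ C, ε < |averageRevenue e A S - expectedRevenue e A D|} ≤ ENNReal.ofReal δ

/-- The sample complexity of uniform convergence over the class `C` for the domain `X`: the least
`M` such that, for every probability distribution on `X`, every sample size `N ≥ M` suffices
(`⊤` if there is none). -/
noncomputable def sampleComplexity (e : Enumeration n m) (X : Set (ValuationVector n m))
    (C : Set (AMA n m)) (ε δ : ℝ) : ℕ∞ :=
  sInf {M : ℕ∞ | ∃ k : ℕ, M = k ∧
    ∀ D : Measure (ValuationVector n m), IsProbabilityMeasure D → (∀ᵐ v ∂D, v ∈ X) →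
      ∀ N : ℕ, k ≤ N → UniformlyConverges e C D ε δ N}

/-- The revenue functions of the auctions in `C` map `X` to `[0, U]`. -/
def RevenueBounded (e : Enumeration n m) (X : Set (ValuationVector n m)) (C : Set (AMA n m)) (U : ℝ) :
    Prop :=
  ∀ A ∈ C, ∀ v ∈ X, A.revenue e v ∈ Set.Icc 0 U

/-- The vectors of additive valuation functions in which every single item has value 0 or 1 for
every bidder. -/
def zeroOneAdditive (n m : ℕ) : Set (ValuationVector n m) :=
  {v | ∀ i, ∃ a : Fin m → ℝ, (∀ j, a j = 0 ∨ a j = 1) ∧ ∀ b, v i b = ∑ j ∈ b, a j}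

/-- `[(U / ε) n^m √m (U + n^{m/2})]²`. -/
noncomputable def rate (n m : ℕ) (U ε : ℝ) : ℝ :=
  (U / ε * (n : ℝ) ^ m * √(m : ℝ) * (U + (n : ℝ) ^ ((m : ℝ) / 2))) ^ 2

end AuctionLearning

/-!
The upper bound rests on the fact that the revenue of an affine maximizer auction is piecewise
linear in suitable parameters: the comparisons of welfare that determine the outcomes are linear in
the weights and boosts, and for given outcomes the revenue is linear in the quotients `w i / w j` and
`λ o / w j`. Treating all of these as independent parameters, together with a threshold `r`, puts the
sets `{v | r ≤ revenue v}` into one class of sets described by the signs of finitely many linear forms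
(`setOf_le_revenue_eq`), with about `n (n + 1) ^ m` parameters and a number of forms whose logarithm
is of order `n m log n`. By the Sauer–Shelah lemma, and since linear forms on a space of dimension
`d` shatter no more than `d` of them, the class picks out only polynomially many subsets of a finite
set of valuations (`ncard_range_signPattern_le`). Symmetrization by a ghost sample and Hoeffding's
inequality for random signs then show that the frequencies of all these sets are close to their
probabilities at once (`measure_exists_frequency_deviates_le`), and integrating over `r ∈ [0, U]` turns
this into a statement about the mean revenue (`abs_average_sub_integral_le`). Symmetrization needs the
set of double samples with a large discrepancy to be measurable. Because the parameters range over
a finite-dimensional space and the forms are jointly continuous, this set is a projection of a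
σ-compact set, hence σ-compact. Boundedness of the revenue enters only in the last step, so the class
of auctions may be an arbitrary set.

For the lower bounds, let each item be of value 1 to exactly one bidder. With unit weights and boosts
0 or `3 / 4` such valuations are always served efficiently. If the efficient allocation has boost `3 / 4`,
the revenue is 0 (`revenue_eq_zero`); if it has boost 0 while allocations that differ only on the items
of one bidder have boost `3 / 4`, that bidder pays at least `3 / 4`, and with two such bidders the revenue
is at least `3 / 2` (`le_revenue`). Boosts of `λ`-auctions can decide independently between the two cases
for all valuations in which two fixed items interest different bidders, and boosts that depend on the
bundle of one bidder can do so for `2 ^ (m - 2)` valuations. Under the uniform distribution on such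
a family, whatever a sample of less than a quarter of its size is, some auction earns nothing on the
sample and at least `9 / 8` in expectation (`not_uniformlyConverges`).
-/

namespace AuctionLearning

/-! ### Sign patterns of linear forms -/

theorem sum_Iic_choose_le_pow (M d : ℕ) : ∑ k ∈ Finset.Iic d, M.choose k ≤ (M + 1) ^ d := by
  induction d with
  | zero =>
    rw [show Finset.Iic 0 = {0} from rfl]
    simp
  | succ d ih =>
    have h : Finset.Iic (d + 1) = insert (d + 1) (Finset.Iic d) := by
      ext k
      simp only [Finset.mem_Iic, Finset.mem_insert]
      omega
    rw [h, Finset.sum_insert (by simp)]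
    calc M.choose (d + 1) + ∑ k ∈ Finset.Iic d, M.choose k
        ≤ M * (M + 1) ^ d + (M + 1) ^ d := by
          refine add_le_add ((Nat.choose_le_pow M (d + 1)).trans ?_) ih
          rw [pow_succ']
          gcongr
          omega
      _ = (M + 1) ^ (d + 1) := by ring

open Classical in
/-- The set of the linear forms among `ℓ` that are positive at `x`. -/
noncomputable def signPattern {E κ : Type*} [AddCommGroup E] [Module ℝ E] [Fintype κ]
    (ℓ : κ → E →ₗ[ℝ] ℝ) (x : E) : Finset κ :=
  Finset.univ.filter fun k => 0 < ℓ k x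

@[simp] theorem mem_signPattern {E κ : Type*} [AddCommGroup E] [Module ℝ E] [Fintype κ]
    (ℓ : κ → E →ₗ[ℝ] ℝ) (x : E) (k : κ) : k ∈ signPattern ℓ x ↔ 0 < ℓ k x := by
  simp [signPattern]

/-- The linear forms on a space of dimension `d` shatter no set of more than `d` of them: in a
linear dependence `∑ c k • ℓ k = 0` the pattern `{k | 0 < c k}` cannot be realized. -/
theorem card_le_finrank_of_shatters {E κ : Type*} [AddCommGroup E] [Module ℝ E]
    [FiniteDimensional ℝ E] [Fintype κ] [DecidableEq κ] (ℓ : κ → E →ₗ[ℝ] ℝ) (s : Finset κ)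
    (hs : ∀ t ⊆ s, ∃ x, s ∩ signPattern ℓ x = t) : s.card ≤ Module.finrank ℝ E := by
  by_contra hlt
  have hdep : ¬ LinearIndependent ℝ (fun k : s => ℓ k) := fun h => by
    have h1 := h.fintype_card_le_finrank
    have h2 : Module.finrank ℝ (E →ₗ[ℝ] ℝ) = Module.finrank ℝ E := Subspace.dual_finrank_eq
    rw [Fintype.card_coe] at h1
    omega
  rw [Fintype.not_linearIndependent_iff] at hdep
  obtain ⟨g, hg, i, hi⟩ := hdep
  -- A dependence with a positive coefficient has no realization of its positive part.
  have key : ∀ c : s → ℝ, ∑ k, c k • ℓ k = 0 → ∀ i, ¬ 0 < c i := by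
    intro c hc i hi
    obtain ⟨x, hx⟩ := hs (s.filter fun k => ∃ h : k ∈ s, 0 < c ⟨k, h⟩) (Finset.filter_subset _ _)
    have hsign : ∀ k : s, 0 < ℓ k x ↔ 0 < c k := fun k => by
      have := Finset.ext_iff.1 hx k
      simpa using this
    have hzero : ∑ k, c k * ℓ k x = 0 := by
      simpa using congrArg (fun f : E →ₗ[ℝ] ℝ => f x) hc
    have hnonneg : ∀ k ∈ Finset.univ, 0 ≤ c k * ℓ k x := fun k _ => by
      by_cases hk : 0 < c k
      · exact mul_nonneg hk.le ((hsign k).2 hk).le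
      · exact mul_nonneg_of_nonpos_of_nonpos (not_lt.1 hk) (not_lt.1 fun h => hk ((hsign k).1 h))
    have := (Finset.sum_eq_zero_iff_of_nonneg hnonneg).1 hzero i (Finset.mem_univ i)
    exact (mul_pos hi ((hsign i).2 hi)).ne' this
  rcases lt_or_gt_of_ne hi with h | h
  · refine key (fun k => -g k) ?_ i (by simpa using h)
    refine LinearMap.ext fun x => ?_
    have hx := congrArg (fun f : E →ₗ[ℝ] ℝ => f x) hg
    simpa using hx
  · exact key g hg i h

/-- By the Sauer–Shelah lemma, finitely many linear forms have polynomially many sign patterns. -/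
theorem ncard_range_signPattern_le {E κ : Type*} [AddCommGroup E] [Module ℝ E]
    [FiniteDimensional ℝ E] [Fintype κ] (ℓ : κ → E →ₗ[ℝ] ℝ) :
    (Set.range (signPattern ℓ)).ncard ≤ (Fintype.card κ + 1) ^ Module.finrank ℝ E := by
  classical
  set 𝒜 : Finset (Finset κ) := (Set.range (signPattern ℓ)).toFinset with h𝒜
  have hvc : 𝒜.vcDim ≤ Module.finrank ℝ E := by
    refine Finset.sup_le fun s hs => card_le_finrank_of_shatters ℓ s fun t ht => ?_
    obtain ⟨u, hu, hut⟩ := (Finset.mem_shatterer.1 hs) ht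
    rw [h𝒜, Set.mem_toFinset] at hu
    obtain ⟨x, rfl⟩ := hu
    exact ⟨x, hut⟩
  calc (Set.range (signPattern ℓ)).ncard = 𝒜.card := Set.ncard_eq_toFinset_card' _
    _ ≤ 𝒜.shatterer.card := 𝒜.card_le_card_shatterer
    _ ≤ ∑ k ∈ Finset.Iic 𝒜.vcDim, (Fintype.card κ).choose k := Finset.card_shatterer_le_sum_vcDim
    _ ≤ (Fintype.card κ + 1) ^ 𝒜.vcDim := sum_Iic_choose_le_pow _ _
    _ ≤ (Fintype.card κ + 1) ^ Module.finrank ℝ E := by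
      gcongr
      omega

/-! ### Random signs -/

theorem sum_signs_exp_le {N : ℕ} (a : Fin N → ℝ) (ha : ∀ t, |a t| ≤ 1) (u : ℝ) :
    ∑ σ : Fin N → Bool, Real.exp (u * ∑ t, (if σ t then a t else -a t)) ≤
      2 ^ N * Real.exp (N * u ^ 2 / 2) := by
  have h1 : ∀ σ : Fin N → Bool, Real.exp (u * ∑ t, (if σ t then a t else -a t)) =
      ∏ t, Real.exp (u * (if σ t then a t else -a t)) := fun σ => by
    rw [Finset.mul_sum, Real.exp_sum]
  have h2 := Finset.prod_univ_sum (fun _ : Fin N => (Finset.univ : Finset Bool))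
    (fun t b => Real.exp (u * (if b then a t else -a t)))
  rw [Fintype.piFinset_univ] at h2
  simp_rw [h1]
  rw [← h2]
  have h3 : ∀ t ∈ (Finset.univ : Finset (Fin N)),
      ∑ b : Bool, Real.exp (u * (if b then a t else -a t)) ≤ 2 * Real.exp (u ^ 2 / 2) := by
    intro t _
    have : ∑ b : Bool, Real.exp (u * (if b then a t else -a t)) = 2 * Real.cosh (u * a t) := by
      rw [Real.cosh_eq]
      simp
      ring
    rw [this]
    have hsq : (u * a t) ^ 2 ≤ u ^ 2 := by
      rw [mul_pow]
      exact mul_le_of_le_one_right (sq_nonneg u) ((sq_le_one_iff_abs_le_one _).2 (ha t))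
    calc 2 * Real.cosh (u * a t) ≤ 2 * Real.exp ((u * a t) ^ 2 / 2) := by
          gcongr
          exact Real.cosh_le_exp_half_sq _
      _ ≤ 2 * Real.exp (u ^ 2 / 2) := by gcongr
  calc ∏ t : Fin N, ∑ b : Bool, Real.exp (u * (if b then a t else -a t))
      ≤ ∏ t : Fin N, (2 * Real.exp (u ^ 2 / 2)) :=
        Finset.prod_le_prod (fun t _ => Finset.sum_nonneg fun b _ => (Real.exp_pos _).le) h3
    _ = 2 ^ N * Real.exp (N * u ^ 2 / 2) := by
        rw [Finset.prod_const, Finset.card_univ, Fintype.card_fin, mul_pow, ← Real.exp_nat_mul]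
        ring_nf

open Classical in
/-- Hoeffding's inequality for random signs, as a count of the sign vectors. -/
theorem card_signs_lt_abs_sum_le {N : ℕ} (hN : 0 < N) (a : Fin N → ℝ) (ha : ∀ t, |a t| ≤ 1)
    {s : ℝ} (hs : 0 ≤ s) :
    ((Finset.univ.filter fun σ : Fin N → Bool =>
      s < |∑ t, (if σ t then a t else -a t)|).card : ℝ) ≤
      2 * (2 ^ N * Real.exp (-(s ^ 2 / (2 * N)))) := by
  have hN' : (0 : ℝ) < N := by exact_mod_cast hN
  set u : ℝ := s / N with hu
  set Y : (Fin N → Bool) → ℝ := fun σ => ∑ t, (if σ t then a t else -a t) with hY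
  have hu0 : 0 ≤ u := by positivity
  have hneg : ∑ σ : Fin N → Bool, Real.exp (-u * Y σ) ≤ 2 ^ N * Real.exp (N * u ^ 2 / 2) := by
    simpa using sum_signs_exp_le a ha (-u)
  have hpos := sum_signs_exp_le a ha u
  have hpt : ∀ σ : Fin N → Bool, (if s < |Y σ| then (1 : ℝ) else 0) ≤
      Real.exp (-(u * s)) * (Real.exp (u * Y σ) + Real.exp (-u * Y σ)) := by
    intro σ
    split_ifs with h
    · rw [mul_add, ← Real.exp_add, ← Real.exp_add]
      rcases lt_abs.1 h with h | h
      · have : 1 ≤ Real.exp (-(u * s) + u * Y σ) := Real.one_le_exp (by nlinarith)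
        linarith [Real.exp_pos (-(u * s) + -u * Y σ)]
      · have : 1 ≤ Real.exp (-(u * s) + -u * Y σ) := Real.one_le_exp (by nlinarith)
        linarith [Real.exp_pos (-(u * s) + u * Y σ)]
    · positivity
  calc ((Finset.univ.filter fun σ : Fin N → Bool => s < |Y σ|).card : ℝ)
      = ∑ σ : Fin N → Bool, (if s < |Y σ| then (1 : ℝ) else 0) := by simp
    _ ≤ ∑ σ : Fin N → Bool, Real.exp (-(u * s)) * (Real.exp (u * Y σ) + Real.exp (-u * Y σ)) :=
        Finset.sum_le_sum fun σ _ => hpt σ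
    _ ≤ Real.exp (-(u * s)) * (2 ^ N * Real.exp (N * u ^ 2 / 2) +
          2 ^ N * Real.exp (N * u ^ 2 / 2)) := by
        rw [← Finset.mul_sum, Finset.sum_add_distrib]
        gcongr
    _ = 2 * (2 ^ N * (Real.exp (-(u * s)) * Real.exp (N * u ^ 2 / 2))) := by ring
    _ = 2 * (2 ^ N * Real.exp (-(s ^ 2 / (2 * N)))) := by
        rw [← Real.exp_add, hu]
        congr 3
        field_simp
        ring

/-! ### Uniform convergence of frequencies -/

open Classical in
/-- The indices of the points of `z` that lie in the set `G θ`. -/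
noncomputable def pickedOut {Ω Θ κ : Type*} [Fintype κ] (G : Θ → Set Ω) (z : κ → Ω) (θ : Θ) :
    Finset κ :=
  Finset.univ.filter fun k => z k ∈ G θ

@[simp] theorem mem_pickedOut {Ω Θ κ : Type*} [Fintype κ] (G : Θ → Set Ω) (z : κ → Ω) (θ : Θ)
    (k : κ) : k ∈ pickedOut G z θ ↔ z k ∈ G θ := by
  simp [pickedOut]

/-- The fraction of the points of the sample `S` that lie in `B`. -/
noncomputable def frequency {Ω : Type*} {N : ℕ} (S : Fin N → Ω) (B : Set Ω) : ℝ :=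
  1 / (N : ℝ) * ∑ t, B.indicator 1 (S t)

/-- By Chebyshev's inequality, a single frequency is close to its probability with probability at
least one half. -/
theorem half_le_measure_frequency_close {Ω : Type*} [MeasurableSpace Ω] (μ : Measure Ω)
    [IsProbabilityMeasure μ] {B : Set Ω} (hB : MeasurableSet B) {N : ℕ} {η : ℝ} (hη : 0 < η)
    (hN : 2 ≤ N * η ^ 2) :
    (1 / 2 : ℝ≥0∞) ≤ Measure.pi (fun _ : Fin N => μ)
      {S | |frequency S B - μ.real B| ≤ η / 2} := by
  have hN0 : (0 : ℝ) < N := by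
    by_contra h
    nlinarith [sq_nonneg η]
  set f : Ω → ℝ := B.indicator 1 with hf
  have hfm : Measurable f := measurable_one.indicator hB
  have hf01 : ∀ ω, f ω ∈ Set.Icc (0 : ℝ) 1 := fun ω => by
    by_cases h : ω ∈ B <;> simp [hf, h]
  have hLp : MemLp f 2 μ :=
    MemLp.of_bound hfm.aestronglyMeasurable 1 (ae_of_all _ fun ω => by
      rw [Real.norm_eq_abs, abs_of_nonneg (hf01 ω).1]
      exact (hf01 ω).2)
  set P := Measure.pi (fun _ : Fin N => μ) with hP
  set X : (Fin N → Ω) → ℝ := ∑ t, fun S : Fin N → Ω => f (S t) with hX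
  have hXapp : ∀ S, X S = ∑ t, f (S t) := fun S => by simp [hX]
  have hLpt : ∀ t : Fin N, MemLp (fun S : Fin N → Ω => f (S t)) 2 P := fun t =>
    hLp.comp_measurePreserving (measurePreserving_eval _ t)
  have hXLp : MemLp X 2 P := by
    rw [hX]
    exact memLp_finsetSum' _ fun t _ => hLpt t
  have hmean : ∫ S, X S ∂P = N * μ.real B := by
    simp_rw [hXapp]
    rw [integral_finsetSum _ fun t _ => (hLpt t).integrable (by norm_num)]
    have : ∀ t : Fin N, ∫ S, f (S t) ∂P = μ.real B := fun t => by
      have h := (measurePreserving_eval (fun _ : Fin N => μ) t).map_eq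
      have h2 : ∫ ω, f ω ∂(P.map (Function.eval t)) = ∫ S, f (S t) ∂P :=
        integral_map (measurable_pi_apply t).aemeasurable hfm.aestronglyMeasurable
      rw [← h2, h, hf, integral_indicator_one hB]
    simp [this]
  have hvar : ProbabilityTheory.variance X P ≤ N / 4 := by
    rw [hX, hP, ProbabilityTheory.variance_sum_pi (X := fun _ => f) fun _ => hLp]
    have := ProbabilityTheory.variance_le_sq_of_bounded (μ := μ) (a := 0) (b := 1)
      (ae_of_all _ hf01) hfm.aemeasurable
    rw [Finset.sum_const, Finset.card_univ, Fintype.card_fin, nsmul_eq_mul]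
    nlinarith
  have hcheb := ProbabilityTheory.meas_ge_le_variance_div_sq hXLp
    (show 0 < N * (η / 2) by positivity)
  rw [hmean] at hcheb
  have hle : ProbabilityTheory.variance X P / (N * (η / 2)) ^ 2 ≤ 1 / 2 := by
    rw [div_le_iff₀ (by positivity)]
    nlinarith
  have hbad : P {S | N * (η / 2) ≤ |X S - N * μ.real B|} ≤ 1 / 2 := by
    refine hcheb.trans ((ENNReal.ofReal_le_ofReal hle).trans ?_)
    rw [ENNReal.ofReal_div_of_pos (by norm_num)]
    simp
  have hXm : Measurable X := by
    rw [funext hXapp]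
    exact Finset.measurable_sum _ fun t _ => hfm.comp (measurable_pi_apply t)
  have hms : MeasurableSet {S | N * (η / 2) ≤ |X S - N * μ.real B|} :=
    measurableSet_le measurable_const (by fun_prop)
  have hsub : {S | N * (η / 2) ≤ |X S - N * μ.real B|}ᶜ ⊆
      {S | |frequency S B - μ.real B| ≤ η / 2} := by
    intro S hS
    simp only [Set.mem_compl_iff, Set.mem_ofPred_eq, not_le] at hS ⊢
    have : X S - N * μ.real B = N * (frequency S B - μ.real B) := by
      rw [frequency, hXapp]
      field_simp
      rfl
    rw [this, abs_mul, abs_of_pos hN0] at hS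
    exact (lt_of_mul_lt_mul_left hS hN0.le).le
  refine le_trans ?_ (measure_mono hsub)
  rw [prob_compl_eq_one_sub hms]
  calc (1 / 2 : ℝ≥0∞) = 1 - 1 / 2 := by simp
    _ ≤ _ := tsub_le_tsub_left hbad _

/-- The double samples on whose two halves the frequencies of some `G θ` differ by more than
`η / 2`. -/
def discrepantPairs {Ω Θ : Type*} (G : Θ → Set Ω) (N : ℕ) (η : ℝ) : Set (Fin N → Ω × Ω) :=
  {z | ∃ θ, N * (η / 2) <
    |∑ t, ((G θ).indicator (1 : Ω → ℝ) (z t).1 - (G θ).indicator (1 : Ω → ℝ) (z t).2)|}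

open Classical in
theorem indicator_sub_eq_of_pickedOut {Ω Θ : Type*} (G : Θ → Set Ω) {N : ℕ} (z : Fin N → Ω × Ω)
    (θ : Θ) (t : Fin N) :
    (G θ).indicator (1 : Ω → ℝ) (z t).1 - (G θ).indicator (1 : Ω → ℝ) (z t).2 =
      (if Sum.inl t ∈ pickedOut G (Sum.elim (fun t => (z t).1) fun t => (z t).2) θ
        then 1 else 0) -
      (if Sum.inr t ∈ pickedOut G (Sum.elim (fun t => (z t).1) fun t => (z t).2) θ
        then 1 else 0) := by
  simp [Set.indicator_apply]

theorem measurableSet_discrepantPairs {Ω Θ : Type*} [MeasurableSpace Ω] (G : Θ → Set Ω) (N : ℕ)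
    (η : ℝ) (hmeas : ∀ s : Finset (Fin N ⊕ Fin N),
      MeasurableSet {z : Fin N ⊕ Fin N → Ω | ∃ θ, pickedOut G z θ = s}) :
    MeasurableSet (discrepantPairs G N η) := by
  classical
  set Φ : (Fin N → Ω × Ω) → (Fin N ⊕ Fin N → Ω) :=
    fun z => Sum.elim (fun t => (z t).1) fun t => (z t).2 with hΦ
  have hΦm : Measurable Φ := by
    refine measurable_pi_iff.2 fun k => ?_
    rcases k with t | t
    · exact measurable_fst.comp (measurable_pi_apply t)
    · exact measurable_snd.comp (measurable_pi_apply t)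
  have : discrepantPairs G N η = ⋃ s ∈ {s : Finset (Fin N ⊕ Fin N) | N * (η / 2) <
      |∑ t : Fin N, ((if Sum.inl t ∈ s then (1 : ℝ) else 0) - (if Sum.inr t ∈ s then 1 else 0))|},
      Φ ⁻¹' {z | ∃ θ, pickedOut G z θ = s} := by
    ext z
    simp only [discrepantPairs, Set.mem_ofPred_eq, Set.mem_iUnion, Set.mem_preimage, exists_prop,
      indicator_sub_eq_of_pickedOut]
    constructor
    · rintro ⟨θ, h⟩
      exact ⟨_, h, θ, rfl⟩
    · rintro ⟨s, h, θ, rfl⟩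
      exact ⟨θ, h⟩
  rw [this]
  exact MeasurableSet.biUnion (Set.to_countable _) fun s _ => hΦm (hmeas s)

/-- Exchange the two members of the pairs `z t` with `σ t = false`. -/
def exchange {Ω : Type*} {N : ℕ} (σ : Fin N → Bool) (z : Fin N → Ω × Ω) : Fin N → Ω × Ω :=
  fun t => if σ t then z t else (z t).swap

open Classical in
theorem card_exchange_mem_discrepantPairs_le {Ω Θ : Type*} (G : Θ → Set Ω) {N : ℕ} (hN : 0 < N)
    {η : ℝ} (hη : 0 < η) {g : ℕ}
    (hg : ∀ z : Fin N ⊕ Fin N → Ω, (Set.range (pickedOut G z)).ncard ≤ g)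
    (z : Fin N → Ω × Ω) :
    ((Finset.univ.filter fun σ : Fin N → Bool =>
      exchange σ z ∈ discrepantPairs G N η).card : ℝ) ≤
      g * (2 * (2 ^ N * Real.exp (-(N * η ^ 2 / 8)))) := by
  have hN' : (0 : ℝ) < N := by exact_mod_cast hN
  set w : Fin N ⊕ Fin N → Ω := Sum.elim (fun t => (z t).1) fun t => (z t).2 with hw
  set a : Finset (Fin N ⊕ Fin N) → Fin N → ℝ := fun s t =>
    (if Sum.inl t ∈ s then 1 else 0) - (if Sum.inr t ∈ s then 1 else 0) with ha
  set R : Finset (Finset (Fin N ⊕ Fin N)) := (Set.range (pickedOut G w)).toFinset with hR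
  have ha1 : ∀ s t, |a s t| ≤ 1 := fun s t => by
    simp only [ha]
    split_ifs <;> simp
  have hsub : (Finset.univ.filter fun σ : Fin N → Bool => exchange σ z ∈ discrepantPairs G N η) ⊆
      R.biUnion fun s => Finset.univ.filter fun σ : Fin N → Bool =>
        N * (η / 2) < |∑ t, (if σ t then a s t else -a s t)| := by
    intro σ hσ
    obtain ⟨θ, hθ⟩ := (Finset.mem_filter.1 hσ).2
    simp only [Finset.mem_biUnion, Finset.mem_filter, Finset.mem_univ, true_and]
    refine ⟨pickedOut G w θ, by rw [hR, Set.mem_toFinset]; exact ⟨θ, rfl⟩, ?_⟩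
    convert hθ using 4 with t
    have h := indicator_sub_eq_of_pickedOut G z θ t
    simp only [ha, hw, ← h, exchange]
    by_cases hs : σ t <;> simp [hs]
  calc ((Finset.univ.filter fun σ : Fin N → Bool =>
        exchange σ z ∈ discrepantPairs G N η).card : ℝ)
      ≤ ∑ s ∈ R, ((Finset.univ.filter fun σ : Fin N → Bool =>
          N * (η / 2) < |∑ t, (if σ t then a s t else -a s t)|).card : ℝ) := by
        exact_mod_cast (Finset.card_le_card hsub).trans Finset.card_biUnion_le
    _ ≤ ∑ s ∈ R, 2 * (2 ^ N * Real.exp (-(N * η ^ 2 / 8))) := by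
        refine Finset.sum_le_sum fun s _ => ?_
        have hexp : (N * (η / 2)) ^ 2 / (2 * N) = N * η ^ 2 / 8 := by
          field_simp
          ring
        rw [← hexp]
        exact card_signs_lt_abs_sum_le hN (a s) (ha1 s) (by positivity)
    _ ≤ g * (2 * (2 ^ N * Real.exp (-(N * η ^ 2 / 8)))) := by
        rw [Finset.sum_const, nsmul_eq_mul]
        gcongr
        rw [hR, ← Set.ncard_eq_toFinset_card']
        exact hg w

theorem measurePreserving_exchange {Ω : Type*} [MeasurableSpace Ω] (μ : Measure Ω)
    [IsProbabilityMeasure μ] {N : ℕ} (σ : Fin N → Bool) :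
    MeasurePreserving (exchange (Ω := Ω) σ) (Measure.pi fun _ => μ.prod μ)
      (Measure.pi fun _ => μ.prod μ) := by
  refine measurePreserving_pi (fun _ : Fin N => μ.prod μ) (fun _ => μ.prod μ)
    (f := fun t p => if σ t then p else p.swap) fun t => ?_
  by_cases h : σ t
  · simpa [h] using! MeasurePreserving.id _
  · simpa [h] using Measure.measurePreserving_swap

/-- Exchanging the members of pairs preserves the distribution of a double sample, so its
discrepancy is bounded by the one of random signs on a worst double sample. -/
theorem measure_discrepantPairs_le {Ω Θ : Type*} [MeasurableSpace Ω] (μ : Measure Ω)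
    [IsProbabilityMeasure μ] (G : Θ → Set Ω) {N : ℕ} (hN : 0 < N) {η : ℝ} (hη : 0 < η) {g : ℕ}
    (hmeas : ∀ s : Finset (Fin N ⊕ Fin N),
      MeasurableSet {z : Fin N ⊕ Fin N → Ω | ∃ θ, pickedOut G z θ = s})
    (hg : ∀ z : Fin N ⊕ Fin N → Ω, (Set.range (pickedOut G z)).ncard ≤ g) :
    Measure.pi (fun _ : Fin N => μ.prod μ) (discrepantPairs G N η) ≤
      ENNReal.ofReal (2 * g * Real.exp (-(N * η ^ 2 / 8))) := by
  classical
  set ν := Measure.pi (fun _ : Fin N => μ.prod μ) with hν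
  set D := discrepantPairs G N η with hD
  have hDm : MeasurableSet D := measurableSet_discrepantPairs G N η hmeas
  have hsum : (2 : ℝ≥0∞) ^ N * ν D ≤
      ENNReal.ofReal (g * (2 * (2 ^ N * Real.exp (-(N * η ^ 2 / 8))))) := by
    calc (2 : ℝ≥0∞) ^ N * ν D = ∑ σ : Fin N → Bool, ν D := by simp
      _ = ∑ σ : Fin N → Bool, ν (exchange σ ⁻¹' D) := by
          refine Finset.sum_congr rfl fun σ _ => ?_
          rw [(measurePreserving_exchange μ σ).measure_preimage hDm.nullMeasurableSet]
      _ = ∑ σ : Fin N → Bool, ∫⁻ z, (exchange σ ⁻¹' D).indicator 1 z ∂ν := by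
          refine Finset.sum_congr rfl fun σ _ => ?_
          rw [lintegral_indicator_one ((measurePreserving_exchange μ σ).measurable hDm)]
      _ = ∫⁻ z, ∑ σ : Fin N → Bool, (exchange σ ⁻¹' D).indicator 1 z ∂ν := by
          rw [lintegral_finsetSum]
          exact fun σ _ =>
            measurable_one.indicator ((measurePreserving_exchange μ σ).measurable hDm)
      _ ≤ ∫⁻ _, ENNReal.ofReal (g * (2 * (2 ^ N * Real.exp (-(N * η ^ 2 / 8))))) ∂ν := by
          refine lintegral_mono fun z => ?_
          refine le_trans (le_of_eq ?_) (ENNReal.ofReal_le_ofReal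
            (card_exchange_mem_discrepantPairs_le G hN hη hg z))
          rw [ENNReal.ofReal_natCast]
          simp [Set.indicator_apply, hD]
      _ = _ := by simp
  have h2 : (2 : ℝ≥0∞) ^ N ≠ 0 := by simp
  have h2' : (2 : ℝ≥0∞) ^ N ≠ ⊤ := by simp
  rw [← ENNReal.mul_le_mul_iff_right h2 h2']
  refine hsum.trans (le_of_eq ?_)
  rw [show (2 : ℝ≥0∞) ^ N = ENNReal.ofReal (2 ^ N) by
    rw [ENNReal.ofReal_pow (by norm_num)]; simp, ← ENNReal.ofReal_mul (by positivity)]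
  congr 1
  ring

/-- Uniform convergence of the frequencies of a class of sets that picks out at most `g` subsets
of any `2 N` points. Measurability is needed only for the sets of double samples from which a given
subset is picked out. -/
theorem measure_exists_frequency_deviates_le {Ω Θ : Type*} [MeasurableSpace Ω] (μ : Measure Ω)
    [IsProbabilityMeasure μ] (G : Θ → Set Ω) (hG : ∀ θ, MeasurableSet (G θ)) {N : ℕ} {η : ℝ}
    (hη : 0 < η) (hN : 2 ≤ N * η ^ 2) {g : ℕ}
    (hmeas : ∀ s : Finset (Fin N ⊕ Fin N),
      MeasurableSet {z : Fin N ⊕ Fin N → Ω | ∃ θ, pickedOut G z θ = s})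
    (hg : ∀ z : Fin N ⊕ Fin N → Ω, (Set.range (pickedOut G z)).ncard ≤ g) :
    Measure.pi (fun _ : Fin N => μ) {S | ∃ θ, η < |frequency S (G θ) - μ.real (G θ)|} ≤
      ENNReal.ofReal (4 * g * Real.exp (-(N * η ^ 2 / 8))) := by
  have hN0 : 0 < N := by
    rcases Nat.eq_zero_or_pos N with rfl | h
    · simp at hN
      linarith
    · exact h
  have hN' : (0 : ℝ) < N := by exact_mod_cast hN0
  set P := Measure.pi (fun _ : Fin N => μ) with hP
  set D := discrepantPairs G N η with hD
  have hDm : MeasurableSet D := measurableSet_discrepantPairs G N η hmeas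
  set e := MeasurableEquiv.arrowProdEquivProdArrow Ω Ω (Fin N) with he
  set D' : Set ((Fin N → Ω) × (Fin N → Ω)) := e.symm ⁻¹' D with hD'
  have hD'm : MeasurableSet D' := e.symm.measurable hDm
  have hmp := measurePreserving_arrowProdEquivProdArrow Ω Ω (Fin N) (fun _ => μ) (fun _ => μ)
  have hDD' : (P.prod P) D' = Measure.pi (fun _ : Fin N => μ.prod μ) D :=
    (hmp.symm e).measure_preimage hDm.nullMeasurableSet
  have hf : Measurable fun S => P (Prod.mk S ⁻¹' D') := measurable_measure_prodMk_left hD'm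
  have hsub : {S | ∃ θ, η < |frequency S (G θ) - μ.real (G θ)|} ⊆
      {S | (1 / 2 : ℝ≥0∞) ≤ P (Prod.mk S ⁻¹' D')} := by
    rintro S ⟨θ, hθ⟩
    refine (half_le_measure_frequency_close μ (hG θ) hη hN).trans (measure_mono fun S' hS' => ?_)
    refine ⟨θ, ?_⟩
    have h1 : η / 2 < |frequency S (G θ) - frequency S' (G θ)| := by
      have h3 := abs_sub_le (frequency S (G θ)) (frequency S' (G θ)) (μ.real (G θ))
      have h4 : |frequency S' (G θ) - μ.real (G θ)| ≤ η / 2 := hS'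
      linarith
    have h2 : ∑ t, ((G θ).indicator (1 : Ω → ℝ) (S t) - (G θ).indicator (1 : Ω → ℝ) (S' t)) =
        N * (frequency S (G θ) - frequency S' (G θ)) := by
      rw [frequency, frequency, Finset.sum_sub_distrib]
      field_simp
    show N * (η / 2) <
      |∑ t, ((G θ).indicator (1 : Ω → ℝ) (S t) - (G θ).indicator (1 : Ω → ℝ) (S' t))|
    rw [h2, abs_mul, abs_of_pos hN']
    gcongr
  have hmarkov := mul_meas_ge_le_lintegral (μ := P) hf (1 / 2)
  rw [← Measure.prod_apply hD'm, hDD'] at hmarkov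
  have hle := measure_discrepantPairs_le μ G hN0 hη hmeas hg
  calc P {S | ∃ θ, η < |frequency S (G θ) - μ.real (G θ)|}
      ≤ P {S | (1 / 2 : ℝ≥0∞) ≤ P (Prod.mk S ⁻¹' D')} := measure_mono hsub
    _ = 2 * (1 / 2 * P {S | (1 / 2 : ℝ≥0∞) ≤ P (Prod.mk S ⁻¹' D')}) := by
        rw [← mul_assoc, one_div, ENNReal.mul_inv_cancel (by simp) (by simp), one_mul]
    _ ≤ 2 * ENNReal.ofReal (2 * g * Real.exp (-(N * η ^ 2 / 8))) := by
        gcongr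
        exact hmarkov.trans hle
    _ = ENNReal.ofReal (4 * g * Real.exp (-(N * η ^ 2 / 8))) := by
        rw [show (2 : ℝ≥0∞) = ENNReal.ofReal 2 by simp, ← ENNReal.ofReal_mul (by norm_num)]
        congr 1
        ring

/-! ### Classes of sets cut out by linear forms -/

theorem measurableSet_of_isSigmaCompact {Y : Type*} [TopologicalSpace Y] [T2Space Y]
    [MeasurableSpace Y] [OpensMeasurableSpace Y] {s : Set Y} (hs : IsSigmaCompact s) :
    MeasurableSet s := by
  obtain ⟨K, hK, rfl⟩ := hs
  exact MeasurableSet.iUnion fun n => (hK n).measurableSet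

/-- A sign condition `0 < h k y` is the union over `l` of the closed conditions
`1 / (l + 1) ≤ h k y`. -/
theorem isSigmaCompact_setOf_sign_eq {Y κ : Type*} [TopologicalSpace Y] [SigmaCompactSpace Y]
    [Finite κ] (h : κ → Y → ℝ) (hc : ∀ k, Continuous (h k)) (p : Finset κ) :
    IsSigmaCompact {y | ∀ k, k ∈ p ↔ 0 < h k y} := by
  have : {y | ∀ k, k ∈ p ↔ 0 < h k y} =
      ⋃ l : ℕ, {y | ∀ k, (k ∈ p → 1 / ((l : ℝ) + 1) ≤ h k y) ∧ (k ∉ p → h k y ≤ 0)} := by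
    ext y
    simp only [Set.mem_ofPred_eq, Set.mem_iUnion]
    constructor
    · intro hy
      have hev : ∀ k, ∀ᶠ l : ℕ in Filter.atTop, k ∈ p → 1 / ((l : ℝ) + 1) ≤ h k y := fun k => by
        by_cases hk : k ∈ p
        · filter_upwards [tendsto_one_div_add_atTop_nhds_zero_nat.eventually_lt_const
            ((hy k).1 hk)] with l hl _ using hl.le
        · exact Filter.Eventually.of_forall fun l h => absurd h hk
      obtain ⟨l, hl⟩ := (Filter.eventually_all.2 hev).exists
      exact ⟨l, fun k => ⟨hl k, fun hk => not_lt.1 fun hlt => hk ((hy k).2 hlt)⟩⟩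
    · rintro ⟨l, hl⟩ k
      refine ⟨fun hk => lt_of_lt_of_le (by positivity) ((hl k).1 hk), fun hk => ?_⟩
      by_contra hkp
      exact absurd ((hl k).2 hkp) (not_le.2 hk)
  rw [this]
  refine isSigmaCompact_iUnion _ fun l => isSigmaCompact_univ.of_isClosed_subset ?_
    (Set.subset_univ _)
  rw [Set.ofPred_forall]
  refine isClosed_iInter fun k => ?_
  by_cases hk : k ∈ p
  · simpa [hk] using isClosed_le continuous_const (hc k)
  · simpa [hk] using isClosed_le (hc k) continuous_const

/-- The sets of points `v` at which the sign pattern of the forms `L j v` at the parameter `x`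
satisfies `Φ`. -/
def semilinearClass {Ω E J : Type*} [AddCommGroup E] [Module ℝ E] [Fintype J]
    (L : J → Ω → (E →ₗ[ℝ] ℝ)) (Φ : Finset J → Prop) (x : E) : Set Ω :=
  {v | Φ (signPattern (fun j => L j v) x)}

section Semilinear

variable {Ω E J : Type*} [AddCommGroup E] [Module ℝ E] [Fintype J]
  (L : J → Ω → (E →ₗ[ℝ] ℝ)) (Φ : Finset J → Prop)

open Classical in
theorem pickedOut_semilinearClass {κ : Type*} [Fintype κ] (z : κ → Ω) (x : E) :
    pickedOut (semilinearClass L Φ) z x = Finset.univ.filter fun k =>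
      Φ (Finset.univ.filter fun j =>
        (k, j) ∈ signPattern (fun q : κ × J => L q.2 (z q.1)) x) := by
  ext k
  rw [mem_pickedOut, Finset.mem_filter]
  have : (Finset.univ.filter fun j => (k, j) ∈ signPattern (fun q : κ × J => L q.2 (z q.1)) x) =
      signPattern (fun j => L j (z k)) x := by
    ext j
    simp
  rw [this]
  simp [semilinearClass]

theorem ncard_range_pickedOut_semilinearClass_le [FiniteDimensional ℝ E] {κ : Type*} [Fintype κ]
    (z : κ → Ω) :
    (Set.range (pickedOut (semilinearClass L Φ) z)).ncard ≤
      (Fintype.card κ * Fintype.card J + 1) ^ Module.finrank ℝ E := by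
  classical
  rw [funext (pickedOut_semilinearClass L Φ z)]
  have := ncard_range_signPattern_le fun q : κ × J => L q.2 (z q.1)
  rw [Fintype.card_prod] at this
  refine le_trans ?_ this
  set Ψ : Finset (κ × J) → Finset κ := fun s => Finset.univ.filter fun k =>
    Φ (Finset.univ.filter fun j => (k, j) ∈ s) with hΨ
  have hcomp := Set.range_comp Ψ (signPattern fun q : κ × J => L q.2 (z q.1))
  refine le_trans (le_of_eq ?_) (Set.ncard_image_le (f := Ψ) (Set.toFinite _))
  exact congrArg Set.ncard hcomp

variable [TopologicalSpace Ω] [T2Space Ω] [SigmaCompactSpace Ω] [MeasurableSpace Ω] [BorelSpace Ω]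
  [TopologicalSpace E]

theorem measurableSet_semilinearClass (hL : ∀ j, Continuous fun q : Ω × E => L j q.1 q.2) (x : E) :
    MeasurableSet (semilinearClass L Φ x) := by
  have : semilinearClass L Φ x = ⋃ p ∈ {p : Finset J | Φ p}, {v | ∀ j, j ∈ p ↔ 0 < L j v x} := by
    ext v
    simp only [semilinearClass, Set.mem_ofPred_eq, Set.mem_iUnion, exists_prop]
    constructor
    · exact fun h => ⟨_, h, fun j => mem_signPattern _ _ _⟩
    · rintro ⟨p, hp, h⟩
      convert hp
      ext j
      rw [mem_signPattern, h]
  rw [this]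
  refine MeasurableSet.biUnion (Set.to_countable _) fun p _ =>
    measurableSet_of_isSigmaCompact (isSigmaCompact_setOf_sign_eq _ (fun j => ?_) p)
  exact (hL j).comp (by fun_prop : Continuous fun v : Ω => (v, x))

/-- The parameter can be projected away, since continuous images of σ-compact sets are
σ-compact. -/
theorem measurableSet_exists_pickedOut_semilinearClass [SecondCountableTopology Ω]
    [SigmaCompactSpace E] (hL : ∀ j, Continuous fun q : Ω × E => L j q.1 q.2) {κ : Type*} [Fintype κ]
    (s : Finset κ) :
    MeasurableSet {z : κ → Ω | ∃ x, pickedOut (semilinearClass L Φ) z x = s} := by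
  classical
  have : {z : κ → Ω | ∃ x, pickedOut (semilinearClass L Φ) z x = s} =
      ⋃ p ∈ {p : Finset (κ × J) | (Finset.univ.filter fun k =>
        Φ (Finset.univ.filter fun j => (k, j) ∈ p)) = s},
      Prod.fst '' {y : (κ → Ω) × E | ∀ q : κ × J, q ∈ p ↔ 0 < L q.2 (y.1 q.1) y.2} := by
    ext z
    simp only [pickedOut_semilinearClass, Set.mem_ofPred_eq, Set.mem_iUnion, exists_prop,
      Set.mem_image, Prod.exists, exists_and_right, exists_eq_right]
    constructor
    · rintro ⟨x, h⟩
      exact ⟨_, h, x, fun q => mem_signPattern _ _ _⟩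
    · rintro ⟨p, hp, x, h⟩
      refine ⟨x, ?_⟩
      rw [← hp]
      have : signPattern (fun q : κ × J => L q.2 (z q.1)) x = p := by
        ext q
        rw [mem_signPattern, h]
      rw [this]
  rw [this]
  refine MeasurableSet.biUnion (Set.to_countable _) fun p _ => measurableSet_of_isSigmaCompact
    ((isSigmaCompact_setOf_sign_eq _ (fun q => ?_) p).image continuous_fst)
  exact (hL q.2).comp (by fun_prop : Continuous fun y : (κ → Ω) × E => (y.1 q.1, y.2))

/-- Uniform convergence of the frequencies of the sets of a semilinear class. -/
theorem measure_exists_frequency_semilinearClass_deviates_le [SecondCountableTopology Ω]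
    [SigmaCompactSpace E] [FiniteDimensional ℝ E]
    (hL : ∀ j, Continuous fun q : Ω × E => L j q.1 q.2) (μ : Measure Ω) [IsProbabilityMeasure μ]
    {N : ℕ} {η : ℝ} (hη : 0 < η) (hN : 2 ≤ N * η ^ 2) :
    Measure.pi (fun _ : Fin N => μ) {S | ∃ x, η <
        |frequency S (semilinearClass L Φ x) - μ.real (semilinearClass L Φ x)|} ≤
      ENNReal.ofReal (4 * (2 * N * Fintype.card J + 1) ^ Module.finrank ℝ E *
        Real.exp (-(N * η ^ 2 / 8))) := by
  have h := measure_exists_frequency_deviates_le μ (semilinearClass L Φ)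
    (measurableSet_semilinearClass L Φ hL) hη hN
    (measurableSet_exists_pickedOut_semilinearClass L Φ hL)
    (ncard_range_pickedOut_semilinearClass_le L Φ)
  refine h.trans (le_of_eq ?_)
  simp only [Fintype.card_sum, Fintype.card_fin]
  push_cast
  rw [two_mul]

end Semilinear

/-! ### Expectations and level sets -/

theorem integrableOn_Ioc_of_antitone {f : ℝ → ℝ} (hf : Antitone f) (U : ℝ) :
    IntegrableOn f (Set.Ioc 0 U) :=
  ((hf.antitoneOn (Set.Icc 0 U)).integrableOn_isCompact isCompact_Icc).mono_set
    Set.Ioc_subset_Icc_self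

theorem antitone_measureReal_levelSet {Ω : Type*} [MeasurableSpace Ω] (μ : Measure Ω)
    [IsProbabilityMeasure μ] (f : Ω → ℝ) : Antitone fun r => μ.real {v | r ≤ f v} :=
  fun _ _ hrs => measureReal_mono fun _ hv => hrs.trans hv

/-- If `f` takes values in `[0, U]`, its average over a sample is within `U * η` of its expectation
when the frequencies of all its upper level sets are within `η` of their probabilities. -/
theorem abs_average_sub_integral_le {Ω : Type*} [MeasurableSpace Ω] (μ : Measure Ω)
    [IsProbabilityMeasure μ] {f : Ω → ℝ} (hf : Measurable f) {U : ℝ} (hU : 0 ≤ U)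
    (hfU : ∀ᵐ v ∂μ, f v ∈ Set.Icc 0 U) {N : ℕ} (S : Fin N → Ω)
    (hS : ∀ t, f (S t) ∈ Set.Icc 0 U) {η : ℝ}
    (h : ∀ r, |frequency S {v | r ≤ f v} - μ.real {v | r ≤ f v}| ≤ η) :
    |1 / (N : ℝ) * ∑ t, f (S t) - ∫ v, f v ∂μ| ≤ U * η := by
  have hint : Integrable f μ := Integrable.of_bound hf.aestronglyMeasurable U (by
    filter_upwards [hfU] with v hv
    rw [Real.norm_eq_abs, abs_of_nonneg hv.1]
    exact hv.2)
  have hE : ∫ v, f v ∂μ = ∫ r in Set.Ioc 0 U, μ.real {v | r ≤ f v} :=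
    hint.integral_eq_integral_Ioc_meas_le (hfU.mono fun v hv => hv.1) (hfU.mono fun v hv => hv.2)
  have hdirac : ∀ t, f (S t) = ∫ r in Set.Ioc 0 U, {v | r ≤ f v}.indicator (1 : Ω → ℝ) (S t) := by
    intro t
    have hae : ∀ᵐ v ∂(Measure.dirac (S t)), f v ∈ Set.Icc 0 U :=
      (ae_dirac_iff (hf measurableSet_Icc)).2 (hS t)
    have hint' : Integrable f (Measure.dirac (S t)) :=
      Integrable.of_bound hf.aestronglyMeasurable U (by
        filter_upwards [hae] with v hv
        rw [Real.norm_eq_abs, abs_of_nonneg hv.1]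
        exact hv.2)
    have := hint'.integral_eq_integral_Ioc_meas_le (hae.mono fun v hv => hv.1)
      (hae.mono fun v hv => hv.2)
    rw [integral_dirac' _ _ hf.stronglyMeasurable] at this
    rw [this]
    congr 1 with r
    have hm : MeasurableSet {v | r ≤ f v} := hf measurableSet_Ici
    rw [measureReal_def, Measure.dirac_apply' _ hm]
    by_cases hr : S t ∈ {v | r ≤ f v}
    · simp only [Set.indicator_of_mem hr]
      simp
    · simp only [Set.indicator_of_notMem hr]
      simp
  have hind : ∀ t, Antitone fun r => {v | r ≤ f v}.indicator (1 : Ω → ℝ) (S t) :=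
    fun t r s hrs => Set.indicator_le_indicator_of_subset (fun v hv => le_trans hrs hv)
      (fun _ => zero_le_one) _
  have hfreq : Antitone fun r => frequency S {v | r ≤ f v} := fun r s hrs => by
    simp only [frequency]
    exact mul_le_mul_of_nonneg_left (Finset.sum_le_sum fun t _ => hind t hrs) (by positivity)
  have hA : 1 / (N : ℝ) * ∑ t, f (S t) = ∫ r in Set.Ioc 0 U, frequency S {v | r ≤ f v} := by
    simp only [frequency]
    rw [integral_const_mul, integral_finsetSum _ fun t _ => integrableOn_Ioc_of_antitone (hind t) U]
    simp_rw [← hdirac]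
  rw [hA, hE, ← integral_sub (integrableOn_Ioc_of_antitone hfreq U)
    (integrableOn_Ioc_of_antitone (antitone_measureReal_levelSet μ f) U), ← Real.norm_eq_abs]
  refine (norm_setIntegral_le_of_norm_le_const (C := η) (by simp) fun r _ => h r).trans
    (le_of_eq ?_)
  rw [Real.volume_real_Ioc_of_le hU]
  ring

variable {n m : ℕ}

/-! ### Revenue thresholds as a semilinear class -/

theorem argmax_eq_iff (e : Enumeration n m) (f : Allocation n m → ℝ) (o : Allocation n m) :
    argmax e f = o ↔ (∀ o', f o' ≤ f o) ∧
      ∀ o', (∀ o'', f o'' ≤ f o') → e.symm o ≤ e.symm o' := by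
  have hmem : ∀ i, i ∈ maximizers e f ↔ ∀ o', f o' ≤ f (e i) := fun i => by simp [maximizers]
  have hmax := (hmem _).1 ((maximizers e f).min'_mem (maximizers_nonempty e f))
  have hmin : ∀ o', (∀ o'', f o'' ≤ f o') →
      (maximizers e f).min' (maximizers_nonempty e f) ≤ e.symm o' := fun o' ho' =>
    Finset.min'_le _ _ ((hmem _).2 (by simpa using ho'))
  constructor
  · rintro rfl
    exact ⟨hmax, by simpa [argmax] using hmin⟩
  · rintro ⟨h1, h2⟩
    rw [argmax, ← Equiv.eq_symm_apply]
    refine le_antisymm (hmin o h1) ?_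
    simpa using h2 _ hmax

theorem le_argmax (e : Enumeration n m) (f : Allocation n m → ℝ) (o : Allocation n m) :
    f o ≤ f (argmax e f) :=
  ((argmax_eq_iff e f _).1 rfl).1 o

/-- The parameters in which outcomes and revenue thresholds of an auction are linear: weights `w i`,
boosts `λ o`, quotients `w i / w j` (at `j`, `i`), quotients `λ o / w j` (at `j`, `o`), and a
threshold. As independent parameters they range over a vector space. -/
abbrev ParameterSpace (n m : ℕ) : Type :=
  (Fin n → ℝ) × (Allocation n m → ℝ) × (Fin n → Fin n → ℝ) × (Fin n → Allocation n m → ℝ) × ℝ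

/-- The bidders whose welfare counts: all of them, or all but one. -/
def participants (k : Option (Fin n)) : Finset (Fin n) :=
  k.elim Finset.univ fun j => Finset.univ.erase j

/-- Boosted weighted welfare of the participants `k`, as a linear form in the parameters. -/
def welfareForm (k : Option (Fin n)) (o : Allocation n m) (v : ValuationVector n m) :
    ParameterSpace n m →ₗ[ℝ] ℝ where
  toFun x := ∑ i ∈ participants k, x.1 i * v i (bundle o i) + x.2.1 o
  map_add' x y := by
    simp [add_mul, Finset.sum_add_distrib]
    ring
  map_smul' c x := by
    simp [mul_assoc, ← Finset.mul_sum, mul_add]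

/-- The payment of bidder `j` when `c none` is the outcome and `c (some j)` is the outcome without
`j`, as a linear form in the parameters. -/
def paymentForm (c : Option (Fin n) → Allocation n m) (j : Fin n) (v : ValuationVector n m) :
    ParameterSpace n m →ₗ[ℝ] ℝ where
  toFun x := (∑ i ∈ Finset.univ.erase j, x.2.2.1 j i * v i (bundle (c (some j)) i) +
      x.2.2.2.1 j (c (some j))) -
    (∑ i ∈ Finset.univ.erase j, x.2.2.1 j i * v i (bundle (c none) i) + x.2.2.2.1 j (c none))
  map_add' x y := by
    simp [add_mul, Finset.sum_add_distrib]
    ring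
  map_smul' c x := by
    simp [mul_assoc, ← Finset.mul_sum, mul_add, mul_sub]

/-- The threshold parameter. -/
def thresholdForm : ParameterSpace n m →ₗ[ℝ] ℝ where
  toFun x := x.2.2.2.2
  map_add' _ _ := rfl
  map_smul' _ _ := rfl

/-- The linear forms whose signs decide whether the revenue reaches the threshold: the comparisons
of the welfare of two allocations, and, for each possible tuple `c` of outcomes, the amount by which
the revenue falls short of the threshold. -/
def auctionForm (q : (Option (Fin n) × Allocation n m × Allocation n m) ⊕
    (Option (Fin n) → Allocation n m)) (v : ValuationVector n m) : ParameterSpace n m →ₗ[ℝ] ℝ :=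
  match q with
  | Sum.inl (k, o, o') => welfareForm k o v - welfareForm k o' v
  | Sum.inr c => thresholdForm - ∑ j, paymentForm c j v

/-- The revenue reaches the threshold, read off from the set `s` of the positive forms. -/
def ReachesThreshold (e : Enumeration n m) (s : Finset ((Option (Fin n) × Allocation n m ×
    Allocation n m) ⊕ (Option (Fin n) → Allocation n m))) : Prop :=
  ∃ c : Option (Fin n) → Allocation n m,
    (∀ k, (∀ o, Sum.inl (k, o, c k) ∉ s) ∧
      ∀ o', (∀ o, Sum.inl (k, o, o') ∉ s) → e.symm (c k) ≤ e.symm o') ∧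
    Sum.inr c ∉ s

theorem continuous_auctionForm (q : (Option (Fin n) × Allocation n m × Allocation n m) ⊕
    (Option (Fin n) → Allocation n m)) :
    Continuous fun y : ValuationVector n m × ParameterSpace n m => auctionForm q y.1 y.2 := by
  rcases q with ⟨k, o, o'⟩ | c
  · simp only [auctionForm, welfareForm, LinearMap.sub_apply, LinearMap.coe_mk, AddHom.coe_mk]
    fun_prop
  · simp only [auctionForm, paymentForm, thresholdForm, LinearMap.sub_apply, LinearMap.coe_mk,
      AddHom.coe_mk, LinearMap.sum_apply]
    fun_prop

/-- The parameters of the auction `A` together with the threshold `r`. -/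
noncomputable def AMA.parameters (A : AMA n m) (r : ℝ) : ParameterSpace n m :=
  (A.weight, A.boost, fun j i => A.weight i / A.weight j, fun j o => A.boost o / A.weight j, r)

/-- The welfare that is maximized with participants `k`. -/
def AMA.welfareOf (A : AMA n m) (v : ValuationVector n m) (k : Option (Fin n))
    (o : Allocation n m) : ℝ :=
  ∑ i ∈ participants k, A.weight i * v i (bundle o i) + A.boost o

theorem revenue_eq_sum_paymentForm (e : Enumeration n m) (A : AMA n m) (v : ValuationVector n m)
    (r : ℝ) : A.revenue e v =
      ∑ j, paymentForm (fun k => argmax e (A.welfareOf v k)) j v (A.parameters r) := by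
  refine Finset.sum_congr rfl fun j _ => ?_
  have h1 : A.outcomeWithout e v j = argmax e (A.welfareOf v (some j)) := rfl
  have h2 : A.outcome e v = argmax e (A.welfareOf v none) := rfl
  have h3 : ∀ o, 1 / A.weight j * A.welfareWithout v j o =
      ∑ i ∈ Finset.univ.erase j, A.weight i / A.weight j * v i (bundle o i) +
        A.boost o / A.weight j := fun o => by
    rw [AMA.welfareWithout, mul_add, Finset.mul_sum]
    exact congrArg₂ _ (Finset.sum_congr rfl fun i _ => by ring) (by ring)
  rw [AMA.payment, h1, h2, mul_sub, h3, h3]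
  rfl

theorem setOf_le_revenue_eq (e : Enumeration n m) (A : AMA n m) (r : ℝ) :
    {v | r ≤ A.revenue e v} =
      semilinearClass auctionForm (ReachesThreshold e) (A.parameters r) := by
  ext v
  simp only [semilinearClass, Set.mem_ofPred_eq, ReachesThreshold, mem_signPattern]
  have hcmp : ∀ k o o', ¬ 0 < auctionForm (Sum.inl (k, o, o')) v (A.parameters r) ↔
      A.welfareOf v k o ≤ A.welfareOf v k o' := fun k o o' => by
    rw [not_lt, ← sub_nonpos (a := A.welfareOf v k o)]
    rfl
  have hrev : ∀ c, ¬ 0 < auctionForm (Sum.inr c) v (A.parameters r) ↔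
      r ≤ ∑ j, paymentForm c j v (A.parameters r) := fun c => by
    rw [not_lt]
    simp [auctionForm, thresholdForm, AMA.parameters]
  simp only [hcmp, hrev, ← argmax_eq_iff]
  rw [revenue_eq_sum_paymentForm e A v r]
  constructor
  · exact fun h => ⟨_, fun k => rfl, h⟩
  · rintro ⟨c, hc, h⟩
    rwa [show (fun k => argmax e (A.welfareOf v k)) = c from funext hc]

theorem measurable_revenue (e : Enumeration n m) (A : AMA n m) : Measurable (A.revenue e) := by
  refine measurable_of_Ici fun r => ?_
  have h := measurableSet_semilinearClass auctionForm (ReachesThreshold e)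
    continuous_auctionForm (A.parameters r)
  rw [← setOf_le_revenue_eq] at h
  exact h

theorem finrank_parameterSpace (n m : ℕ) : Module.finrank ℝ (ParameterSpace n m) =
    n + ((n + 1) ^ m + (n * n + (n * (n + 1) ^ m + 1))) := by
  simp [Module.finrank_pi_fintype]

/-- The number of linear forms that decide whether a revenue threshold is reached. -/
def formCount (n m : ℕ) : ℕ :=
  (n + 1) * ((n + 1) ^ m * (n + 1) ^ m) + ((n + 1) ^ m) ^ (n + 1)

/-- Uniform convergence of the revenue of all affine maximizer auctions whose revenue lies in
`[0, U]`, at a sample size that makes the right-hand side small. -/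
theorem measure_exists_averageRevenue_deviates_le (e : Enumeration n m) (C : Set (AMA n m))
    (X : Set (ValuationVector n m)) {U : ℝ} (hU : 0 < U) (hC : RevenueBounded e X C U)
    (D : Measure (ValuationVector n m)) [IsProbabilityMeasure D] (hD : ∀ᵐ v ∂D, v ∈ X) {ε : ℝ}
    (hε : 0 < ε) {N : ℕ} (hN : 2 ≤ N * (ε / U) ^ 2) :
    Measure.pi (fun _ : Fin N => D)
      {S | ∃ A ∈ C, ε < |averageRevenue e A S - expectedRevenue e A D|} ≤
    ENNReal.ofReal (4 * (2 * N * formCount n m + 1) ^ Module.finrank ℝ (ParameterSpace n m) *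
      Real.exp (-(N * (ε / U) ^ 2 / 8))) := by
  have h := measure_exists_frequency_semilinearClass_deviates_le auctionForm (ReachesThreshold e)
    continuous_auctionForm D (show 0 < ε / U by positivity) hN
  have hcard : Fintype.card ((Option (Fin n) × Allocation n m × Allocation n m) ⊕
      (Option (Fin n) → Allocation n m)) = formCount n m := by
    simp [formCount]
  rw [hcard] at h
  refine le_trans (measure_mono_ae ?_) h
  have hS : ∀ᵐ S ∂(Measure.pi fun _ : Fin N => D), ∀ t, S t ∈ X :=
    ae_all_iff.2 fun t => (Measure.quasiMeasurePreserving_eval (fun _ : Fin N => D) t).ae hD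
  filter_upwards [hS] with S hSX
  rintro ⟨A, hA, hlt⟩
  by_contra hno
  have hno' : ∀ x, |frequency S (semilinearClass auctionForm (ReachesThreshold e) x) -
      D.real (semilinearClass auctionForm (ReachesThreshold e) x)| ≤ ε / U := fun x =>
    not_lt.1 fun hx => hno ⟨x, hx⟩
  have hle := abs_average_sub_integral_le D (measurable_revenue e A) hU.le
    (hD.mono fun v hv => hC A hA v hv) S (fun t => hC A hA _ (hSX t)) (η := ε / U) fun r => by
      rw [setOf_le_revenue_eq]
      exact hno' _
  rw [mul_div_cancel₀ _ hU.ne'] at hle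
  exact absurd hlt (not_lt.2 hle)

/-! ### The sample size for the upper bound -/

theorem sq_mul_succ_pow_le (hn : 2 ≤ n) (hm : 1 ≤ m) :
    n ^ 2 * (n + 1) ^ m ≤ 2 * n ^ (3 * m) := by
  obtain ⟨k, rfl⟩ : ∃ k, m = k + 1 := ⟨m - 1, by omega⟩
  calc n ^ 2 * (n + 1) ^ (k + 1) = n ^ 2 * (n + 1) * (n + 1) ^ k := by ring
    _ ≤ n ^ 2 * (2 * n) * (n ^ 3) ^ k := by
        gcongr
        · omega
        · nlinarith [Nat.mul_le_mul hn hn]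
    _ = 2 * n ^ (3 * (k + 1)) := by ring

theorem mul_finrank_parameterSpace_le (hn : 2 ≤ n) (hm : 1 ≤ m) :
    n * Module.finrank ℝ (ParameterSpace n m) ≤ 10 * n ^ (3 * m) := by
  have h := sq_mul_succ_pow_le hn hm
  have ha : n + 1 ≤ (n + 1) ^ m := Nat.le_self_pow (by omega) _
  rw [finrank_parameterSpace]
  set a := (n + 1) ^ m
  have h1 : n + (a + (n * n + (n * a + 1))) ≤ 5 * (n * a) := by nlinarith
  calc n * (n + (a + (n * n + (n * a + 1)))) ≤ n * (5 * (n * a)) := Nat.mul_le_mul_left _ h1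
    _ = 5 * (n ^ 2 * a) := by ring
    _ ≤ 10 * n ^ (3 * m) := by omega

theorem formCount_le (hn : 2 ≤ n) (hm : 1 ≤ m) :
    formCount n m ≤ 2 * (n + 1) ^ (m * (n + 1)) := by
  have ha : n + 1 ≤ (n + 1) ^ m := Nat.le_self_pow (by omega) _
  rw [formCount, pow_mul]
  set a := (n + 1) ^ m
  have h1 : (n + 1) * (a * a) ≤ a ^ (n + 1) :=
    calc (n + 1) * (a * a) ≤ a * (a * a) := by gcongr
      _ = a ^ 3 := by ring
      _ ≤ a ^ (n + 1) := Nat.pow_le_pow_right (by omega) (by omega)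
  omega

theorem log_succ_le_two_mul_log (hn : 2 ≤ n) : Real.log (n + 1) ≤ 2 * Real.log n := by
  have hn' : (2 : ℝ) ≤ n := by exact_mod_cast hn
  rw [← Real.log_rpow (by linarith)]
  refine Real.log_le_log (by linarith) ?_
  rw [show (2 : ℝ) = (2 : ℕ) by norm_num, Real.rpow_natCast]
  nlinarith

/-- The logarithm of the number of linear forms is at most `n` up to logarithmic factors. -/
theorem log_three_mul_formCount_le (hn : 2 ≤ n) (hm : 1 ≤ m) {B : ℝ}
    (hB : (n : ℝ) ^ (3 * m) ≤ B) (hL : 1 ≤ Real.log (2 + B)) :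
    Real.log (3 * formCount n m) ≤ 3 * n * Real.log (2 + B) := by
  have hn' : (2 : ℝ) ≤ n := by exact_mod_cast hn
  set L := Real.log (2 + B)
  have hF0 : (0 : ℝ) < formCount n m := by
    rw [formCount]
    positivity
  have hF : (3 : ℝ) * formCount n m ≤ 6 * ((n : ℝ) + 1) ^ (m * (n + 1)) := by
    have : (formCount n m : ℝ) ≤ 2 * ((n : ℝ) + 1) ^ (m * (n + 1)) := by
      exact_mod_cast formCount_le hn hm
    linarith
  have hlog6 : Real.log 6 ≤ 2 := by
    rw [Real.log_le_iff_le_exp (by norm_num)]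
    have := Real.exp_one_gt_d9
    rw [show (2 : ℝ) = 1 + 1 by norm_num, Real.exp_add]
    nlinarith
  have hmL : 3 * (m * Real.log n) ≤ L := by
    have : Real.log ((n : ℝ) ^ (3 * m)) ≤ L :=
      Real.log_le_log (by positivity) (by linarith)
    rw [Real.log_pow] at this
    push_cast at this
    linarith
  have hmL' : m * Real.log (n + 1) ≤ L := by
    have h1 := mul_le_mul_of_nonneg_left (log_succ_le_two_mul_log hn) (Nat.cast_nonneg (α := ℝ) m)
    have h2 : 0 ≤ m * Real.log n := mul_nonneg (Nat.cast_nonneg _) (Real.log_nonneg (by linarith))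
    linarith
  calc Real.log (3 * formCount n m)
      ≤ Real.log (6 * ((n : ℝ) + 1) ^ (m * (n + 1))) := Real.log_le_log (by positivity) hF
    _ = Real.log 6 + (n + 1) * (m * Real.log (n + 1)) := by
        rw [Real.log_mul (by norm_num) (by positivity), Real.log_pow]
        push_cast
        ring
    _ ≤ 2 * L + (n + 1) * L := by
        refine add_le_add (by linarith) ?_
        gcongr
    _ ≤ 3 * n * L := by nlinarith

/-- At sample size `1600 B log (2 + B) log (2 / δ)` the bound for the probability of a deviation
is at most `δ`. -/
theorem deviation_bound_le (hn : 2 ≤ n) (hm : 1 ≤ m) {η δ B : ℝ} (hη : 0 < η) (hη1 : η < 1)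
    (hδ : 0 < δ) (hδ1 : δ < 1) (hB : (n : ℝ) ^ (3 * m) ≤ B * η ^ 2) {N : ℕ}
    (hN : 1600 * B * Real.log (2 + B) * Real.log (2 / δ) ≤ N) :
    2 ≤ N * η ^ 2 ∧
    4 * (2 * N * formCount n m + 1) ^ Module.finrank ℝ (ParameterSpace n m) *
      Real.exp (-(N * η ^ 2 / 8)) ≤ δ := by
  have hn' : (2 : ℝ) ≤ n := by exact_mod_cast hn
  set T : ℝ := (n : ℝ) ^ (3 * m) with hT
  have hT8 : 8 ≤ T := by
    calc (8 : ℝ) = 2 ^ (3 * 1) := by norm_num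
      _ ≤ (n : ℝ) ^ (3 * 1) := by gcongr
      _ ≤ T := pow_le_pow_right₀ (by linarith) (by omega)
  have hη2 : η ^ 2 ≤ 1 := pow_le_one₀ hη.le hη1.le
  have hη0 : 0 < η ^ 2 := by positivity
  have hB0 : 0 < B := by
    by_contra h
    nlinarith
  have hTB : T ≤ B := by nlinarith
  set L := Real.log (2 + B) with hLdef
  have hL : 1 ≤ L := by
    rw [hLdef, Real.le_log_iff_exp_le (by linarith)]
    linarith [Real.exp_one_lt_d9]
  set l := Real.log (2 / δ) with hldef
  have hl2 : Real.log 2 ≤ l :=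
    Real.log_le_log (by norm_num) (by rw [le_div_iff₀ hδ]; linarith)
  have hl : 0.69 ≤ l := by linarith [Real.log_two_gt_d9]
  have hlδ : Real.log δ = Real.log 2 - l := by
    rw [hldef, Real.log_div (by norm_num) hδ.ne']
    ring
  set M : ℝ := N * η ^ 2 with hM
  have hML : 1600 * (T * L * l) ≤ M := by
    calc 1600 * (T * L * l) ≤ 1600 * (B * η ^ 2 * L * l) := by gcongr
      _ = 1600 * B * L * l * η ^ 2 := by ring
      _ ≤ M := by rw [hM]; gcongr
  have hTL : 8 ≤ T * L := by nlinarith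
  have hTLl : 0.69 * (T * L) ≤ T * L * l := by nlinarith
  have hTLl' : 8 * l ≤ T * L * l := by nlinarith
  have hM2 : 2 ≤ M := by nlinarith
  refine ⟨hM2, ?_⟩
  have hN0 : (0 : ℝ) < N := by
    by_contra h
    nlinarith
  have hN1 : (1 : ℝ) ≤ N := by
    have : 0 < N := by exact_mod_cast hN0
    exact_mod_cast this
  set F : ℝ := (formCount n m : ℝ) with hF
  have hF1 : 1 ≤ F := by
    rw [hF]
    have : 0 < formCount n m := by
      rw [formCount]
      positivity
    exact_mod_cast this
  set d := Module.finrank ℝ (ParameterSpace n m) with hd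
  have hd0 : (0 : ℝ) < d := by
    have : 0 < d := by
      rw [hd, finrank_parameterSpace]
      omega
    exact_mod_cast this
  have hnd : (n : ℝ) * d ≤ 10 * T := by
    have h : ((n * d : ℕ) : ℝ) ≤ ((10 * n ^ (3 * m) : ℕ) : ℝ) :=
      Nat.cast_le.2 (mul_finrank_parameterSpace_le hn hm)
    push_cast at h
    exact h
  have hdT : (d : ℝ) ≤ 10 * T := by nlinarith
  -- `log N` is replaced by its tangent at `32 d / η²`, which is linear in `N` with a small slope.
  have hlogN : d * Real.log N ≤ M / 32 + d * (7 * L) := by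
    set α : ℝ := 32 * d / η ^ 2 with hα
    have hα0 : 0 < α := by positivity
    have h1 : Real.log N ≤ N / α + Real.log α := by
      have h2 := Real.log_le_sub_one_of_pos (show 0 < N / α by positivity)
      rw [Real.log_div hN0.ne' hα0.ne'] at h2
      linarith
    have h3 : Real.log α ≤ 7 * L := by
      have h4 : α ≤ 320 * (2 + B) := by
        rw [hα, div_le_iff₀ hη0]
        nlinarith
      have h5 : Real.log 320 ≤ 6 := by
        rw [Real.log_le_iff_le_exp (by norm_num)]
        have h6 : (2.7 : ℝ) ≤ Real.exp 1 := by linarith [Real.exp_one_gt_d9]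
        calc (320 : ℝ) ≤ 2.7 ^ 6 := by norm_num
          _ ≤ Real.exp 1 ^ 6 := by gcongr
          _ = Real.exp 6 := by
              rw [← Real.exp_nat_mul]
              norm_num
      calc Real.log α ≤ Real.log (320 * (2 + B)) := Real.log_le_log hα0 h4
        _ = Real.log 320 + L := Real.log_mul (by norm_num) (by linarith)
        _ ≤ 7 * L := by linarith
    calc d * Real.log N ≤ d * (N / α + 7 * L) := by gcongr; linarith
      _ = M / 32 + d * (7 * L) := by
          rw [hα, hM]
          field_simp
  have hlogF : d * Real.log (3 * F) ≤ 30 * (T * L) := by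
    have h1 := log_three_mul_formCount_le hn hm hTB hL
    calc d * Real.log (3 * F) ≤ d * (3 * n * L) := by gcongr
      _ = 3 * (n * d) * L := by ring
      _ ≤ 3 * (10 * T) * L := by gcongr
      _ = 30 * (T * L) := by ring
  have hdL : d * (7 * L) ≤ 70 * (T * L) := by
    calc d * (7 * L) ≤ 10 * T * (7 * L) := by gcongr
      _ = 70 * (T * L) := by ring
  have hlog4 : Real.log 4 = 2 * Real.log 2 := by
    rw [show (4 : ℝ) = 2 ^ 2 by norm_num, Real.log_pow]
    norm_num
  have hbase : 2 * N * F + 1 ≤ N * (3 * F) := by nlinarith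
  have hexp : Real.log 4 + d * (Real.log N + Real.log (3 * F)) - M / 8 ≤ Real.log δ := by
    rw [hlog4, hlδ, mul_add]
    linarith
  calc 4 * (2 * N * F + 1) ^ d * Real.exp (-(M / 8))
      ≤ 4 * (N * (3 * F)) ^ d * Real.exp (-(M / 8)) := by gcongr
    _ = Real.exp (Real.log 4 + d * (Real.log N + Real.log (3 * F)) - M / 8) := by
        rw [sub_eq_add_neg, Real.exp_add, Real.exp_add, Real.exp_log (by norm_num),
          Real.exp_nat_mul, Real.exp_add, Real.exp_log hN0, Real.exp_log (by positivity)]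
    _ ≤ Real.exp (Real.log δ) := Real.exp_le_exp.2 hexp
    _ = δ := Real.exp_log hδ

theorem pow_le_rate_mul (hm : 1 ≤ m) {U ε : ℝ} (hU : 0 < U) (hε : 0 < ε) :
    (n : ℝ) ^ (3 * m) ≤ rate n m U ε * (ε / U) ^ 2 := by
  have hm' : (1 : ℝ) ≤ m := by exact_mod_cast hm
  have hn0 : (0 : ℝ) ≤ n := Nat.cast_nonneg n
  set y : ℝ := (n : ℝ) ^ ((m : ℝ) / 2) with hy
  have hy0 : 0 ≤ y := Real.rpow_nonneg hn0 _
  have hy2 : y ^ 2 = (n : ℝ) ^ m := by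
    rw [hy, ← Real.rpow_natCast, ← Real.rpow_mul hn0]
    simp
  have h1 : rate n m U ε * (ε / U) ^ 2 = ((n : ℝ) ^ m) ^ 2 * m * (U + y) ^ 2 := by
    have hs : √(m : ℝ) ^ 2 = m := Real.sq_sqrt (by linarith)
    rw [rate, ← hy, mul_pow, mul_pow, mul_pow, hs]
    field_simp
  rw [h1]
  calc (n : ℝ) ^ (3 * m) = ((n : ℝ) ^ m) ^ 2 * 1 * y ^ 2 := by
        rw [hy2]
        ring
    _ ≤ ((n : ℝ) ^ m) ^ 2 * m * (U + y) ^ 2 := by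
        gcongr
        linarith

theorem averageRevenue_mem_Icc {e : Enumeration n m} {A : AMA n m} {U : ℝ} (hU : 0 ≤ U) {N : ℕ}
    {S : Fin N → ValuationVector n m} (hS : ∀ t, A.revenue e (S t) ∈ Set.Icc 0 U) :
    averageRevenue e A S ∈ Set.Icc 0 U := by
  constructor
  · exact mul_nonneg (by positivity) (Finset.sum_nonneg fun t _ => (hS t).1)
  · have h : ∑ t, A.revenue e (S t) ≤ N * U :=
      (Finset.sum_le_sum fun t _ => (hS t).2).trans (by simp)
    rcases Nat.eq_zero_or_pos N with rfl | hN
    · simpa [averageRevenue] using hU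
    · have hN' : (0 : ℝ) < N := by exact_mod_cast hN
      rw [averageRevenue, one_div, inv_mul_le_iff₀ hN']
      exact h

theorem expectedRevenue_mem_Icc {e : Enumeration n m} {A : AMA n m} {U : ℝ}
    (D : Measure (ValuationVector n m)) [IsProbabilityMeasure D]
    (hD : ∀ᵐ v ∂D, A.revenue e v ∈ Set.Icc 0 U) : expectedRevenue e A D ∈ Set.Icc 0 U := by
  have hint : Integrable (A.revenue e) D :=
    Integrable.of_bound (measurable_revenue e A).aestronglyMeasurable U (by
      filter_upwards [hD] with v hv
      rw [Real.norm_eq_abs, abs_of_nonneg hv.1]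
      exact hv.2)
  refine ⟨integral_nonneg_of_ae (hD.mono fun v hv => hv.1), ?_⟩
  calc ∫ v, A.revenue e v ∂D ≤ ∫ _, U ∂D :=
        integral_mono_ae hint (integrable_const U) (hD.mono fun v hv => hv.2)
    _ = U := by simp

theorem sampleComplexity_le (e : Enumeration n m) (X : Set (ValuationVector n m))
    (C : Set (AMA n m)) {ε δ : ℝ} {M : ℕ}
    (h : ∀ D : Measure (ValuationVector n m), IsProbabilityMeasure D → (∀ᵐ v ∂D, v ∈ X) →
      ∀ N : ℕ, M ≤ N → UniformlyConverges e C D ε δ N) :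
    (sampleComplexity e X C ε δ : ℝ≥0∞) ≤ M := by
  have : sampleComplexity e X C ε δ ≤ M := sInf_le ⟨M, rfl, h⟩
  exact_mod_cast ENat.toENNReal_le.2 this

/-- If the revenue varies by at most `ε`, no samples are needed. -/
theorem uniformlyConverges_of_le (e : Enumeration n m) (X : Set (ValuationVector n m))
    (C : Set (AMA n m)) {U ε δ : ℝ} (hU : 0 ≤ U) (hUε : U ≤ ε) (hC : RevenueBounded e X C U)
    (D : Measure (ValuationVector n m)) [IsProbabilityMeasure D] (hD : ∀ᵐ v ∂D, v ∈ X) (N : ℕ) :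
    UniformlyConverges e C D ε δ N := by
  refine le_of_eq_of_le ?_ zero_le
  have hS : ∀ᵐ S ∂(Measure.pi fun _ : Fin N => D), ∀ t, S t ∈ X :=
    ae_all_iff.2 fun t => (Measure.quasiMeasurePreserving_eval (fun _ : Fin N => D) t).ae hD
  rw [measure_eq_zero_iff_ae_notMem]
  filter_upwards [hS] with S hSX
  rintro ⟨A, hA, hlt⟩
  have h1 := averageRevenue_mem_Icc hU fun t => hC A hA _ (hSX t)
  have h2 := expectedRevenue_mem_Icc D (hD.mono fun v hv => hC A hA v hv)
  have h3 : |averageRevenue e A S - expectedRevenue e A D| ≤ U :=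
    abs_le.2 ⟨by linarith [h1.1, h2.2], by linarith [h1.2, h2.1]⟩
  linarith

theorem sampleComplexity_le_rate (hn : 2 ≤ n) (hm : 1 ≤ m) (e : Enumeration n m)
    (C : Set (AMA n m)) (X : Set (ValuationVector n m)) {U : ℝ} (hC : RevenueBounded e X C U)
    (hU : 0 ≤ U) {ε δ : ℝ} (hε : 0 < ε) (hδ : 0 < δ) (hδ1 : δ < 1) :
    (sampleComplexity e X C ε δ : ℝ≥0∞) ≤ ENNReal.ofReal
      (1601 * rate n m U ε * Real.log (2 + rate n m U ε) ^ 1 * Real.log (2 / δ)) := by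
  rw [pow_one]
  rcases le_or_gt U ε with hUε | hUε
  · refine (sampleComplexity_le e X C (M := 0) fun D hP hD N _ =>
      uniformlyConverges_of_le e X C hU hUε hC D hD N).trans ?_
    simp
  have hU0 : 0 < U := hε.trans hUε
  have hη : 0 < ε / U := by positivity
  have hη1 : ε / U < 1 := (div_lt_one hU0).2 hUε
  set B := rate n m U ε with hBdef
  have hB : (n : ℝ) ^ (3 * m) ≤ B * (ε / U) ^ 2 := pow_le_rate_mul hm hU0 hε
  have hB8 : 8 ≤ B := by
    have h8 : (8 : ℝ) ≤ (n : ℝ) ^ (3 * m) := by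
      have : 2 ^ (3 * 1) ≤ n ^ (3 * m) :=
        (Nat.pow_le_pow_left hn _).trans (Nat.pow_le_pow_right (by omega) (by omega))
      exact_mod_cast this
    have h1 : (ε / U) ^ 2 ≤ 1 := pow_le_one₀ hη.le hη1.le
    have h0 : 0 ≤ B := sq_nonneg _
    nlinarith
  have hL : 1 ≤ Real.log (2 + B) := by
    rw [Real.le_log_iff_exp_le (by linarith)]
    linarith [Real.exp_one_lt_d9]
  have hl : 0.69 ≤ Real.log (2 / δ) := by
    have : Real.log 2 ≤ Real.log (2 / δ) :=
      Real.log_le_log (by norm_num) (by rw [le_div_iff₀ hδ]; linarith)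
    linarith [Real.log_two_gt_d9]
  have hBL : 8 ≤ B * Real.log (2 + B) := by nlinarith
  have hBLl : 1 ≤ B * Real.log (2 + B) * Real.log (2 / δ) := by nlinarith
  refine (sampleComplexity_le e X C
    (M := ⌈1600 * B * Real.log (2 + B) * Real.log (2 / δ)⌉₊) fun D hP hD N hN => ?_).trans ?_
  · obtain ⟨h2, hle⟩ := deviation_bound_le hn hm hη hη1 hδ hδ1 hB
      ((Nat.le_ceil _).trans (Nat.cast_le.2 hN))
    exact (measure_exists_averageRevenue_deviates_le e C X hU0 hC D hD hε h2).trans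
      (ENNReal.ofReal_le_ofReal hle)
  · rw [← ENNReal.ofReal_natCast]
    refine ENNReal.ofReal_le_ofReal ?_
    have hceil := Nat.ceil_lt_add_one
      (show 0 ≤ 1600 * B * Real.log (2 + B) * Real.log (2 / δ) by positivity)
    nlinarith

/-! ### Revenue on additive valuations with item values 0 and 1 -/

theorem payment_nonneg (e : Enumeration n m) (A : AMA n m) (v : ValuationVector n m) (j : Fin n) :
    0 ≤ A.payment e v j :=
  mul_nonneg (one_div_nonneg.2 (A.weight_pos j).le) (sub_nonneg.2 (le_argmax e _ _))

theorem welfare_eq_welfareWithout_add (A : AMA n m) (v : ValuationVector n m) (j : Fin n)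
    (o : Allocation n m) :
    A.welfare v o = A.welfareWithout v j o + A.weight j * v j (bundle o j) := by
  rw [AMA.welfare, AMA.welfareWithout, ← Finset.add_sum_erase _ _ (Finset.mem_univ j)]
  ring

/-- No bidder with nonnegative values pays more than the value of the bundle received. -/
theorem payment_le_value (e : Enumeration n m) (A : AMA n m) (v : ValuationVector n m) (j : Fin n)
    (hv : ∀ b, 0 ≤ v j b) : A.payment e v j ≤ v j (bundle (A.outcome e v) j) := by
  have hw := A.weight_pos j
  have h1 : A.welfare v (A.outcomeWithout e v j) ≤ A.welfare v (A.outcome e v) := le_argmax e _ _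
  rw [welfare_eq_welfareWithout_add A v j, welfare_eq_welfareWithout_add A v j] at h1
  have h2 := mul_nonneg hw.le (hv (bundle (A.outcomeWithout e v j) j))
  rw [AMA.payment, one_div, inv_mul_le_iff₀ hw]
  linarith

theorem sum_card_bundle_le (o : Allocation n m) : ∑ i, (bundle o i).card ≤ m := by
  classical
  rw [← Finset.card_biUnion]
  · exact (Finset.card_le_univ _).trans (by simp)
  · intro i _ j _ hij
    refine Finset.disjoint_left.2 ?_
    intro x hx hx'
    simp only [bundle, Finset.mem_filter, Finset.mem_univ, true_and] at hx hx'
    exact hij (Option.some_injective _ (hx.symm.trans hx'))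

theorem revenueBounded_zeroOneAdditive (e : Enumeration n m) (C : Set (AMA n m)) :
    RevenueBounded e (zeroOneAdditive n m) C m := by
  intro A _ v hv
  have hval : ∀ i b, 0 ≤ v i b ∧ v i b ≤ b.card := fun i b => by
    obtain ⟨a, ha, hb⟩ := hv i
    have h01 : ∀ j, 0 ≤ a j ∧ a j ≤ 1 := fun j => by
      rcases ha j with h | h <;> simp [h]
    rw [hb]
    refine ⟨Finset.sum_nonneg fun j _ => (h01 j).1, ?_⟩
    exact (Finset.sum_le_sum fun j _ => (h01 j).2).trans (by simp)
  refine ⟨Finset.sum_nonneg fun j _ => payment_nonneg e A v j, ?_⟩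
  calc A.revenue e v ≤ ∑ j, ((bundle (A.outcome e v) j).card : ℝ) :=
        Finset.sum_le_sum fun j _ => (payment_le_value e A v j fun b => (hval j b).1).trans
          (hval j _).2
    _ ≤ m := by exact_mod_cast sum_card_bundle_le _

/-- The additive valuations in which item `j` has value 1 for bidder `a j` and 0 for all others. -/
def soleInterest (a : Fin m → Fin n) : ValuationVector n m :=
  fun i b => ((b.filter fun j => a j = i).card : ℝ)

theorem soleInterest_mem (a : Fin m → Fin n) : soleInterest a ∈ zeroOneAdditive n m := fun i =>
  ⟨fun j => if a j = i then 1 else 0, fun j => by by_cases h : a j = i <;> simp [h],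
    fun b => by simp [soleInterest]⟩

theorem soleInterest_injective : Function.Injective (soleInterest (n := n) (m := m)) := by
  intro a a' h
  ext j
  have h1 := congrFun (congrFun h (a j)) {j}
  simp only [soleInterest, Finset.filter_singleton, if_true, Finset.card_singleton] at h1
  by_cases h2 : a' j = a j
  · rw [h2]
  · simp [h2] at h1

/-- The auction with unit weights and boosts `b`. -/
def unitAuction (b : Allocation n m → ℝ) : AMA n m where
  weight _ := 1
  weight_pos _ := one_pos
  boost := b

theorem sum_weight_mul_soleInterest (b : Allocation n m → ℝ) (a : Fin m → Fin n)
    (s : Finset (Fin n)) (o : Allocation n m) :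
    ∑ i ∈ s, (unitAuction b).weight i * soleInterest a i (bundle o i) =
      ((Finset.univ.filter fun j => o j = some (a j) ∧ a j ∈ s).card : ℝ) := by
  have h : ∀ i ∈ s, (unitAuction b).weight i * soleInterest a i (bundle o i) =
      ∑ j, if o j = some i ∧ a j = i then (1 : ℝ) else 0 := fun i _ => by
    simp [unitAuction, soleInterest, bundle, Finset.filter_filter]
  rw [Finset.sum_congr rfl h, Finset.sum_comm, ← Finset.sum_boole]
  refine Finset.sum_congr rfl fun j _ => ?_
  by_cases hj : a j ∈ s
  · rw [Finset.sum_eq_single (a j) (fun i _ hi => by simp [hi.symm]) fun h => absurd hj h]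
    simp [hj]
  · rw [Finset.sum_eq_zero fun i hi => ?_]
    · simp [hj]
    · have : a j ≠ i := fun h => hj (h ▸ hi)
      simp [this]

theorem welfare_soleInterest (b : Allocation n m → ℝ) (a : Fin m → Fin n) (o : Allocation n m) :
    (unitAuction b).welfare (soleInterest a) o =
      ((Finset.univ.filter fun j => o j = some (a j)).card : ℝ) + b o := by
  rw [AMA.welfare, sum_weight_mul_soleInterest]
  simp [unitAuction]

theorem welfareWithout_soleInterest (b : Allocation n m → ℝ) (a : Fin m → Fin n) (k : Fin n)
    (o : Allocation n m) :
    (unitAuction b).welfareWithout (soleInterest a) k o =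
      ((Finset.univ.filter fun j => o j = some (a j) ∧ a j ≠ k).card : ℝ) + b o := by
  rw [AMA.welfareWithout, sum_weight_mul_soleInterest]
  simp [unitAuction]

/-- Boosts below 1 do not change the efficient allocation, in which each item goes to the bidder
interested in it. -/
theorem outcome_soleInterest (e : Enumeration n m) {b : Allocation n m → ℝ}
    (hb : ∀ o, b o ∈ Set.Icc (0 : ℝ) (3 / 4)) (a : Fin m → Fin n) :
    (unitAuction b).outcome e (soleInterest a) = fun j => some (a j) := by
  have hlt : ∀ o : Allocation n m, o ≠ (fun j => some (a j)) →
      (unitAuction b).welfare (soleInterest a) o <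
        (unitAuction b).welfare (soleInterest a) fun j => some (a j) := by
    intro o ho
    rw [welfare_soleInterest, welfare_soleInterest]
    have hcard : (Finset.univ.filter fun j => o j = some (a j)).card + 1 ≤ m := by
      have hss : (Finset.univ.filter fun j => o j = some (a j)) ⊂ Finset.univ := by
        rw [Finset.filter_ssubset]
        by_contra hno
        push Not at hno
        exact ho (funext fun j => hno j (Finset.mem_univ j))
      have := Finset.card_lt_card hss
      rw [Finset.card_univ, Fintype.card_fin] at this
      omega
    have hcard' : ((Finset.univ.filter fun j => o j = some (a j)).card : ℝ) + 1 ≤ m := by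
      exact_mod_cast hcard
    have h1 := (hb o).2
    have h2 := (hb fun j => some (a j)).1
    simp only [Finset.filter_true, Finset.card_univ, Fintype.card_fin]
    linarith
  rw [AMA.outcome, argmax_eq_iff]
  refine ⟨fun o => ?_, fun o ho => ?_⟩
  · rcases eq_or_ne o fun j => some (a j) with rfl | h
    · exact le_rfl
    · exact (hlt o h).le
  · rcases eq_or_ne o fun j => some (a j) with rfl | h
    · exact le_rfl
    · exact absurd (ho _) (not_le.2 (hlt o h))

theorem payment_unitAuction (e : Enumeration n m) {b : Allocation n m → ℝ}
    (hb : ∀ o, b o ∈ Set.Icc (0 : ℝ) (3 / 4)) (a : Fin m → Fin n) (k : Fin n) :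
    (unitAuction b).payment e (soleInterest a) k =
      (unitAuction b).welfareWithout (soleInterest a) k
        ((unitAuction b).outcomeWithout e (soleInterest a) k) -
      (((Finset.univ.filter fun j => a j ≠ k).card : ℝ) + b fun j => some (a j)) := by
  rw [AMA.payment, outcome_soleInterest e hb,
    welfareWithout_soleInterest b a k fun j => some (a j)]
  simp [unitAuction]

/-- If the efficient allocation has the highest boost, nobody pays. -/
theorem revenue_eq_zero (e : Enumeration n m) {b : Allocation n m → ℝ}
    (hb : ∀ o, b o ∈ Set.Icc (0 : ℝ) (3 / 4)) {a : Fin m → Fin n}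
    (ha : (b fun j => some (a j)) = 3 / 4) : (unitAuction b).revenue e (soleInterest a) = 0 := by
  refine Finset.sum_eq_zero fun k _ => le_antisymm ?_ (payment_nonneg _ _ _ _)
  rw [payment_unitAuction e hb, welfareWithout_soleInterest, ha]
  set o := (unitAuction b).outcomeWithout e (soleInterest a) k
  have h1 : ((Finset.univ.filter fun j => o j = some (a j) ∧ a j ≠ k).card : ℝ) ≤
      (Finset.univ.filter fun j => a j ≠ k).card := by
    exact_mod_cast Finset.card_le_card
      (Finset.monotone_filter_right _ fun j _ (h : o j = some (a j) ∧ a j ≠ k) => h.2)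
  linarith [(hb o).2]

/-- If the efficient allocation has boost 0 and reassigning the items of bidder `k` can reach a
boost of `3 / 4`, then `k` pays at least `3 / 4`. -/
theorem le_payment (e : Enumeration n m) {b : Allocation n m → ℝ}
    (hb : ∀ o, b o ∈ Set.Icc (0 : ℝ) (3 / 4)) {a : Fin m → Fin n}
    (ha : (b fun j => some (a j)) = 0) {k : Fin n} {o : Allocation n m}
    (ho : ∀ j, a j ≠ k → o j = some (a j)) (hbo : b o = 3 / 4) :
    3 / 4 ≤ (unitAuction b).payment e (soleInterest a) k := by
  have h : (unitAuction b).welfareWithout (soleInterest a) k o ≤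
      (unitAuction b).welfareWithout (soleInterest a) k
        ((unitAuction b).outcomeWithout e (soleInterest a) k) := le_argmax e _ _
  have h2 : (Finset.univ.filter fun j => o j = some (a j) ∧ a j ≠ k) =
      Finset.univ.filter fun j => a j ≠ k :=
    Finset.filter_congr fun j _ => ⟨fun h => h.2, fun h => ⟨ho j h, h⟩⟩
  rw [welfareWithout_soleInterest b a k o, h2, hbo] at h
  rw [payment_unitAuction e hb, ha]
  linarith

theorem le_revenue (e : Enumeration n m) {b : Allocation n m → ℝ}
    (hb : ∀ o, b o ∈ Set.Icc (0 : ℝ) (3 / 4)) {a : Fin m → Fin n}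
    (ha : (b fun j => some (a j)) = 0) {k k' : Fin n} (hk : k ≠ k') {o o' : Allocation n m}
    (ho : ∀ j, a j ≠ k → o j = some (a j)) (hbo : b o = 3 / 4)
    (ho' : ∀ j, a j ≠ k' → o' j = some (a j)) (hbo' : b o' = 3 / 4) :
    3 / 2 ≤ (unitAuction b).revenue e (soleInterest a) := by
  have h1 := le_payment e hb ha ho hbo
  have h2 := le_payment e hb ha ho' hbo'
  have h3 : ∑ j ∈ {k, k'}, (unitAuction b).payment e (soleInterest a) j ≤
      (unitAuction b).revenue e (soleInterest a) :=
    Finset.sum_le_sum_of_subset_of_nonneg (Finset.subset_univ _)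
      fun j _ _ => payment_nonneg _ _ _ _
  rw [Finset.sum_pair hk] at h3
  linarith

/-! ### Lower bounds from shattered valuations -/

/-- The uniform distribution on the values of `v`. -/
noncomputable def uniformOnRange {ι : Type*} [Fintype ι] (v : ι → ValuationVector n m) :
    Measure (ValuationVector n m) :=
  (Fintype.card ι : ℝ≥0∞)⁻¹ • ∑ h, Measure.dirac (v h)

theorem isProbabilityMeasure_uniformOnRange {ι : Type*} [Fintype ι] [Nonempty ι]
    (v : ι → ValuationVector n m) : IsProbabilityMeasure (uniformOnRange v) := by
  refine ⟨?_⟩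
  simp only [uniformOnRange, Measure.smul_apply, Measure.finsetSum_apply, measure_univ,
    Finset.sum_const, Finset.card_univ, nsmul_eq_mul, mul_one, smul_eq_mul]
  exact ENNReal.inv_mul_cancel (by simp) (by simp)

theorem ae_mem_range_uniformOnRange {ι : Type*} [Fintype ι] (v : ι → ValuationVector n m) :
    ∀ᵐ x ∂(uniformOnRange v), x ∈ Set.range v := by
  have hm : MeasurableSet (Set.range v)ᶜ := (Set.finite_range v).measurableSet.compl
  rw [ae_iff]
  show uniformOnRange v (Set.range v)ᶜ = 0
  simp [uniformOnRange, Measure.finsetSum_apply, Measure.dirac_apply' _ hm]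

theorem expectedRevenue_uniformOnRange {ι : Type*} [Fintype ι] (e : Enumeration n m) (A : AMA n m)
    (v : ι → ValuationVector n m) :
    expectedRevenue e A (uniformOnRange v) =
      (Fintype.card ι : ℝ)⁻¹ * ∑ h, A.revenue e (v h) := by
  have hsm := (measurable_revenue e A).stronglyMeasurable
  rw [expectedRevenue, uniformOnRange, integral_smul_measure, integral_finsetSum_measure]
  · simp [integral_dirac' _ _ hsm]
  · exact fun h _ => integrable_dirac' hsm (by simp)

/-- If the auctions of `C` can earn nothing on any prescribed part of a finite set of valuations
and at least `3 / 2` on the rest, then a sample much smaller than that set always leaves an auction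
that earns nothing on the sample and more than 1 in expectation. -/
theorem not_uniformlyConverges {ι : Type*} [Fintype ι] (e : Enumeration n m) (C : Set (AMA n m))
    {v : ι → ValuationVector n m} (hv : Function.Injective v)
    (hC : ∀ T : Set ι, ∃ A ∈ C, (∀ h ∈ T, A.revenue e (v h) = 0) ∧
      ∀ h ∉ T, 3 / 2 ≤ A.revenue e (v h)) {ε δ : ℝ} (hε : ε < 1) (hδ : δ < 1) {N : ℕ}
    (hN : 4 * N < Fintype.card ι) : ¬ UniformlyConverges e C (uniformOnRange v) ε δ N := by
  classical
  have hcard : 0 < Fintype.card ι := by omega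
  have : Nonempty ι := Fintype.card_pos_iff.1 hcard
  have := isProbabilityMeasure_uniformOnRange v
  intro hconv
  have hS : ∀ᵐ S ∂(Measure.pi fun _ : Fin N => uniformOnRange v), ∀ t, S t ∈ Set.range v :=
    ae_all_iff.2 fun t => (Measure.quasiMeasurePreserving_eval
      (fun _ : Fin N => uniformOnRange v) t).ae (ae_mem_range_uniformOnRange v)
  have hall : ∀ᵐ S ∂(Measure.pi fun _ : Fin N => uniformOnRange v), S ∈ {S | ∃ A ∈ C,
      ε < |averageRevenue e A S - expectedRevenue e A (uniformOnRange v)|} := by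
    filter_upwards [hS] with S hSv
    set T : Finset ι := Finset.univ.filter fun h => ∃ t, S t = v h with hT
    have hTcard : T.card ≤ N := by
      rw [← Finset.card_image_of_injective T hv]
      calc (T.image v).card ≤ (Finset.univ.image S).card := by
            refine Finset.card_le_card fun x hx => ?_
            obtain ⟨h, hh, rfl⟩ := Finset.mem_image.1 hx
            obtain ⟨t, ht⟩ := (Finset.mem_filter.1 hh).2
            exact Finset.mem_image.2 ⟨t, Finset.mem_univ t, ht⟩
        _ ≤ N := Finset.card_image_le.trans (by simp)
    obtain ⟨A, hA, hA0, hA1⟩ := hC T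
    refine ⟨A, hA, ?_⟩
    have havg : averageRevenue e A S = 0 := by
      rw [averageRevenue, Finset.sum_eq_zero, mul_zero]
      intro t _
      obtain ⟨h, hh⟩ := hSv t
      rw [← hh]
      exact hA0 h (by simp [hT]; exact ⟨t, hh.symm⟩)
    have hsum : 3 / 2 * ((Fintype.card ι : ℝ) - N) ≤ ∑ h, A.revenue e (v h) := by
      calc 3 / 2 * ((Fintype.card ι : ℝ) - N) ≤ 3 / 2 * ((Tᶜ).card : ℝ) := by
            rw [Finset.card_compl, Nat.cast_sub (Finset.card_le_univ T)]
            have : (T.card : ℝ) ≤ N := by exact_mod_cast hTcard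
            linarith
        _ = ∑ h ∈ Tᶜ, (3 / 2 : ℝ) := by
            rw [Finset.sum_const, nsmul_eq_mul]
            ring
        _ ≤ ∑ h ∈ Tᶜ, A.revenue e (v h) :=
            Finset.sum_le_sum fun h hh => hA1 h (by simpa using hh)
        _ ≤ ∑ h, A.revenue e (v h) := by
            rw [← Finset.sum_add_sum_compl T, Finset.sum_eq_zero hA0, zero_add]
    have hN' : 4 * (N : ℝ) ≤ Fintype.card ι := by exact_mod_cast hN.le
    have hcard' : (0 : ℝ) < Fintype.card ι := by exact_mod_cast hcard
    have hE : 1 ≤ expectedRevenue e A (uniformOnRange v) := by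
      rw [expectedRevenue_uniformOnRange, le_inv_mul_iff₀ hcard']
      linarith
    rw [havg, zero_sub, abs_neg]
    exact hε.trans_le (hE.trans (le_abs_self _))
  have h1 : (1 : ℝ≥0∞) ≤ ENNReal.ofReal δ := by
    refine le_trans ?_ hconv
    rw [← measure_univ (μ := Measure.pi fun _ : Fin N => uniformOnRange v)]
    exact measure_mono_ae (hall.mono fun _ hS _ => hS)
  rw [ENNReal.one_le_ofReal] at h1
  linarith

theorem le_sampleComplexity {ι : Type*} [Fintype ι] (e : Enumeration n m) (C : Set (AMA n m))
    {X : Set (ValuationVector n m)} {v : ι → ValuationVector n m} (hv : Function.Injective v)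
    (hvX : ∀ h, v h ∈ X) (hC : ∀ T : Set ι, ∃ A ∈ C, (∀ h ∈ T, A.revenue e (v h) = 0) ∧
      ∀ h ∉ T, 3 / 2 ≤ A.revenue e (v h)) {ε δ : ℝ} (hε : ε < 1) (hδ : δ < 1) {x : ℝ}
    (hx : 4 * x ≤ Fintype.card ι) :
    ENNReal.ofReal x ≤ (sampleComplexity e X C ε δ : ℝ≥0∞) := by
  have hle : (⌈x⌉₊ : ℕ∞) ≤ sampleComplexity e X C ε δ := by
    refine le_sInf ?_
    rintro _ ⟨N, rfl, hN⟩
    by_contra hlt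
    rw [Nat.cast_le, Nat.ceil_le, not_le] at hlt
    have hcard : 4 * N < Fintype.card ι := by
      have : 4 * (N : ℝ) < Fintype.card ι := by linarith
      exact_mod_cast this
    have : Nonempty ι := Fintype.card_pos_iff.1 (by omega)
    refine not_uniformlyConverges e C hv hC hε hδ hcard
      (hN _ (isProbabilityMeasure_uniformOnRange v) ?_ N le_rfl)
    filter_upwards [ae_mem_range_uniformOnRange v] with x hx
    obtain ⟨h, rfl⟩ := hx
    exact hvX h
  calc ENNReal.ofReal x ≤ ((⌈x⌉₊ : ℕ) : ℝ≥0∞) := by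
        rw [← ENNReal.ofReal_natCast]
        exact ENNReal.ofReal_le_ofReal (Nat.le_ceil x)
    _ ≤ _ := by exact_mod_cast ENat.toENNReal_le.2 hle

/-! ### Lower bound for `λ`-auctions -/

theorem pow_le_two_mul_card_ne (hn : 2 ≤ n) {j j' : Fin m} (hj : j ≠ j') :
    n ^ m ≤ 2 * Fintype.card {a : Fin m → Fin n // a j ≠ a j'} := by
  classical
  have : NeZero n := ⟨by omega⟩
  have hone : (1 : Fin n) ≠ 0 := fun h => by
    have h' := congrArg Fin.val h
    rw [Fin.val_one', Fin.val_zero, Nat.mod_eq_of_lt (by omega)] at h'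
    omega
  -- Changing the value at `j` by 1 maps the `a` with `a j = a j'` into those with `a j ≠ a j'`.
  have hle : Fintype.card {a : Fin m → Fin n // ¬ a j ≠ a j'} ≤
      Fintype.card {a : Fin m → Fin n // a j ≠ a j'} := by
    refine Fintype.card_le_of_injective
      (fun a => ⟨Function.update a.1 j (a.1 j + 1), ?_⟩) ?_
    · have ha : a.1 j = a.1 j' := not_not.1 a.2
      rw [Function.update_self, Function.update_of_ne hj.symm, ← ha]
      simpa using hone
    · intro a a' h
      have h' := congrArg Subtype.val h
      refine Subtype.ext (funext fun i => ?_)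
      have hi := congrFun h' i
      by_cases hij : i = j
      · subst hij
        simpa using hi
      · simpa [Function.update_of_ne hij] using hi
  have hcard := Fintype.card_subtype_compl fun a : Fin m → Fin n => a j ≠ a j'
  have hsub := Fintype.card_subtype_le fun a : Fin m → Fin n => a j ≠ a j'
  have htot : Fintype.card (Fin m → Fin n) = n ^ m := by simp
  rw [htot] at hcard hsub
  omega

theorem le_sampleComplexity_lambda (hn : 2 ≤ n) (hm : 2 ≤ m) (e : Enumeration n m)
    {C : Set (AMA n m)}
    (hC : {A ∈ lambdaAuctions n m | ∀ o, A.boost o ∈ Set.Icc (0 : ℝ) 1} ⊆ C) {ε δ : ℝ}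
    (hε : ε < 1) (hδ : δ < 1) :
    ENNReal.ofReal (1 / 16 * (n : ℝ) ^ m) ≤
      (sampleComplexity e (zeroOneAdditive n m) C ε δ : ℝ≥0∞) := by
  classical
  set j₀ : Fin m := ⟨0, by omega⟩ with hj₀
  set j₁ : Fin m := ⟨1, by omega⟩ with hj₁
  have hj : j₀ ≠ j₁ := by simp [hj₀, hj₁]
  have hcard := pow_le_two_mul_card_ne hn hj
  have hcard' : (n : ℝ) ^ m ≤ 2 * Fintype.card {a : Fin m → Fin n // a j₀ ≠ a j₁} := by
    exact_mod_cast hcard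
  refine le_sampleComplexity e C (v := fun a : {a : Fin m → Fin n // a j₀ ≠ a j₁} =>
    soleInterest a.1) (soleInterest_injective.comp Subtype.val_injective)
    (fun a => soleInterest_mem a.1) (fun T => ?_) hε hδ (by
      have : (0 : ℝ) ≤ (n : ℝ) ^ m := by positivity
      linarith)
  set b : Allocation n m → ℝ := fun o =>
    if ∃ a : {a : Fin m → Fin n // a j₀ ≠ a j₁}, a ∉ T ∧ o = fun j => some (a.1 j)
      then 0 else 3 / 4 with hb
  have hbI : ∀ o, b o ∈ Set.Icc (0 : ℝ) (3 / 4) := fun o => by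
    simp only [hb]
    split_ifs <;> norm_num
  refine ⟨unitAuction b, hC ⟨fun i => rfl, fun o => ⟨(hbI o).1, (hbI o).2.trans (by norm_num)⟩⟩,
    fun a ha => revenue_eq_zero e hbI ?_, fun a ha => ?_⟩
  · refine if_neg ?_
    rintro ⟨a', ha', h⟩
    have : a = a' := Subtype.ext (funext fun j => Option.some_injective _ (congrFun h j))
    exact ha' (this ▸ ha)
  · -- Leaving the items of a bidder unassigned reaches the high boost.
    have hout : ∀ j, b (fun i => if a.1 i = a.1 j then none else some (a.1 i)) = 3 / 4 := fun j => by
      refine if_neg ?_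
      rintro ⟨a', -, h⟩
      simpa using congrFun h j
    have hagree : ∀ j i, a.1 i ≠ a.1 j →
        (if a.1 i = a.1 j then none else some (a.1 i)) = some (a.1 i) := fun j i h => if_neg h
    exact le_revenue e hbI (if_pos ⟨a, ha, rfl⟩) a.2 (hagree j₀) (hout j₀) (hagree j₁) (hout j₁)

/-! ### Lower bound for virtual valuation combinatorial auctions -/

theorem pow_le_four_mul_card_separating {j j' : Fin m} (hj : j ≠ j') :
    2 ^ m ≤ 4 * Fintype.card {b : Finset (Fin m) // j ∈ b ∧ j' ∉ b} := by
  classical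
  have h := Fintype.card_le_of_injective
    (fun b : Finset (Fin m) => ((⟨insert j (b.erase j'), by simp, by simp [hj.symm]⟩, decide (j ∈ b),
      decide (j' ∈ b)) : {b : Finset (Fin m) // j ∈ b ∧ j' ∉ b} × Bool × Bool)) (by
      intro b b' hbb
      simp only [Prod.mk.injEq, Subtype.mk.injEq, decide_eq_decide] at hbb
      obtain ⟨h1, h2, h3⟩ := hbb
      ext i
      by_cases hi : i = j
      · rw [hi, h2]
      by_cases hi' : i = j'
      · rw [hi', h3]
      · simpa [hi, hi'] using Finset.ext_iff.1 h1 i)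
  simp only [Fintype.card_finset, Fintype.card_fin, Fintype.card_prod, Fintype.card_bool] at h
  omega

theorem le_sampleComplexity_VVCA (hn : 2 ≤ n) (hm : 2 ≤ m) (e : Enumeration n m)
    {C : Set (AMA n m)}
    (hC : {A ∈ VVCAs n m | (∀ i, A.weight i = 1) ∧ ∀ o, A.boost o ∈ Set.Icc (0 : ℝ) 1} ⊆ C)
    {ε δ : ℝ} (hε : ε < 1) (hδ : δ < 1) :
    ENNReal.ofReal (1 / 16 * (2 : ℝ) ^ m) ≤
      (sampleComplexity e (zeroOneAdditive n m) C ε δ : ℝ≥0∞) := by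
  classical
  set j₀ : Fin m := ⟨0, by omega⟩ with hj₀
  set j₁ : Fin m := ⟨1, by omega⟩ with hj₁
  have hj : j₀ ≠ j₁ := by simp [hj₀, hj₁]
  set p : Fin n := ⟨0, by omega⟩ with hp
  set q : Fin n := ⟨1, by omega⟩ with hq
  have hpq : p ≠ q := by simp [hp, hq]
  set a : {b : Finset (Fin m) // j₀ ∈ b ∧ j₁ ∉ b} → Fin m → Fin n :=
    fun h j => if j ∈ h.1 then p else q with ha
  have hap : ∀ h j, a h j = p ↔ j ∈ h.1 := fun h j => by
    simp only [ha]
    split_ifs with hjh <;> simp [hjh, hpq.symm]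
  have hbundle : ∀ h, bundle (fun j => some (a h j)) p = h.1 := fun h => by
    ext j
    simp [bundle, hap]
  have hainj : Function.Injective a := fun h h' hh => Subtype.ext (by
    rw [← hbundle h, ← hbundle h', hh])
  have hcard := pow_le_four_mul_card_separating hj
  have hcard' : (2 : ℝ) ^ m ≤ 4 * Fintype.card {b : Finset (Fin m) // j₀ ∈ b ∧ j₁ ∉ b} := by
    exact_mod_cast hcard
  refine le_sampleComplexity e C (v := fun h => soleInterest (a h))
    (soleInterest_injective.comp hainj) (fun h => soleInterest_mem (a h)) (fun T => ?_) hε hδ (by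
      linarith)
  -- The boost depends only on the bundle of bidder `p`.
  set c : Finset (Fin m) → ℝ := fun b => if ∃ h, h ∉ T ∧ b = h.1 then 0 else 3 / 4 with hc
  set b : Allocation n m → ℝ := fun o => c (bundle o p) with hb
  have hbI : ∀ o, b o ∈ Set.Icc (0 : ℝ) (3 / 4) := fun o => by
    simp only [hb, hc]
    split_ifs <;> norm_num
  refine ⟨unitAuction b, hC ⟨⟨fun i s => if i = p then c s else 0, fun o => by
    simp [unitAuction, hb]⟩, fun i => rfl, fun o => ⟨(hbI o).1, (hbI o).2.trans (by norm_num)⟩⟩,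
    fun h hh => revenue_eq_zero e hbI ?_, fun h hh => ?_⟩
  · simp only [hb, hbundle]
    refine if_neg ?_
    rintro ⟨h', hh', heq⟩
    exact hh' ((Subtype.ext heq : h = h') ▸ hh)
  · have h0 : a h j₀ = p := (hap h j₀).2 h.2.1
    have h1 : a h j₁ = q := if_neg h.2.2
    refine le_revenue e hbI (k := p) (k' := q)
      (o := fun j => if j = j₀ then none else some (a h j))
      (o' := fun j => if j = j₁ then some p else some (a h j)) ?_ hpq ?_ ?_ ?_ ?_
    · simp only [hb, hbundle]
      exact if_pos ⟨h, hh, rfl⟩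
    · intro j hj
      refine if_neg fun hjj => hj ?_
      rw [hjj, h0]
    · refine if_neg ?_
      rintro ⟨h', -, heq⟩
      have := heq ▸ h'.2.1
      simp [bundle] at this
    · intro j hj
      refine if_neg fun hjj => hj ?_
      rw [hjj, h1]
    · refine if_neg ?_
      rintro ⟨h', -, heq⟩
      refine h'.2.2 (heq ▸ ?_)
      simp [bundle]

end AuctionLearning

open AuctionLearning in
theorem theorem1 :
    (∃ K : ℝ, 0 < K ∧ ∃ k : ℕ, ∀ n m : ℕ, 2 ≤ n → 1 ≤ m →
      ∀ (e : Enumeration n m) (F : Set (AMA n m)),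
        F ∈ ({AMAs n m, VVCAs n m, lambdaAuctions n m} : Set (Set (AMA n m))) →
      ∀ C ⊆ F, ∀ (X : Set (ValuationVector n m)) (U : ℝ), RevenueBounded e X C U → 0 ≤ U →
      ∀ ε ∈ Set.Ioo (0 : ℝ) 1, ∀ δ ∈ Set.Ioo (0 : ℝ) 1,
        (sampleComplexity e X C ε δ : ℝ≥0∞) ≤
          ENNReal.ofReal
            (K * rate n m U ε * Real.log (2 + rate n m U ε) ^ k * Real.log (2 / δ))) ∧
    (∃ c : ℝ, 0 < c ∧ ∀ n m : ℕ, 2 ≤ n → 2 ≤ m → ∀ e : Enumeration n m,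
      RevenueBounded e (zeroOneAdditive n m) (AMAs n m) m ∧
      ∀ ε ∈ Set.Ioo (0 : ℝ) 1, ∀ δ ∈ Set.Ioo (0 : ℝ) 1,
        (∀ C : Set (AMA n m),
          {A ∈ lambdaAuctions n m | ∀ o, A.boost o ∈ Set.Icc (0 : ℝ) 1} ⊆ C →
          ENNReal.ofReal (c * (n : ℝ) ^ m) ≤
            (sampleComplexity e (zeroOneAdditive n m) C ε δ : ℝ≥0∞)) ∧
        (∀ C : Set (AMA n m),
          {A ∈ VVCAs n m | (∀ i, A.weight i = 1) ∧ ∀ o, A.boost o ∈ Set.Icc (0 : ℝ) 1} ⊆ C →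
          ENNReal.ofReal (c * (2 : ℝ) ^ m) ≤
            (sampleComplexity e (zeroOneAdditive n m) C ε δ : ℝ≥0∞))) := by
  refine ⟨⟨1601, by norm_num, 1, ?_⟩, 1 / 16, by norm_num, ?_⟩
  · intro n m hn hm e F _ C _ X U hC hU ε hε δ hδ
    exact sampleComplexity_le_rate hn hm e C X hC hU hε.1 hδ.1 hδ.2
  · intro n m hn hm e
    refine ⟨revenueBounded_zeroOneAdditive e _, fun ε hε δ hδ => ⟨fun C hC => ?_, fun C hC => ?_⟩⟩
    · exact le_sampleComplexity_lambda hn hm e hC hε.2 hδ.2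
    · exact le_sampleComplexity_VVCA hn hm e hC hε.2 hδ.2
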